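/- Let $\mathcal F$ be a signature (a set of function symbols with fixed arities) and $\mathcal V$ an infinite set of variables, and let $\mathcal T(\mathcal F,\mathcal V)$ be the set of terms. A \emph{context} is a term over $\mathcal F\cup\{\square\}$ and $\mathcal V$, where the hole $\square$ is a fresh constant. Contexts are ordered by $\sqsubseteq$, the least reflexive, transitive and monotone (closed under function application) relation with $\square\sqsubseteq C$ for all contexts $C$; $\sqcup$ denotes the corresponding partial binary supremum. For a context $C$, let $\mathrm{Pos}_{\mathcal F}(C)$ be the set of positions of $C$ that carry a symbol of $\mathcal F$. A TRS $\mathcal R$ over $\mathcal F$ is a set of rules $\ell\to r$ between terms such that $\ell$ is not a variable and every variable of $r$ occurs in $\ell$. We write $s\to_{p,\ell\to r}t$ for a rewrite step at position $p$ with rule $\ell\to r$, and $\to_{\mathcal R}$ for the rewrite relation of $\mathcal R$. A relation is confluent on a set $S$ if $S$ is closed under it and its restriction to $S$ is confluent. Let $\mathbb L$ be a set of contexts. A \emph{top} of a context $C$ is an $L\in\mathbb L$ with $L\sqsubseteq C$, and a \emph{max-top} is a $\sqsubseteq$-maximal top. $\mathbb L$ is a \emph{layer system} if (L1) each term has a top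 different from $\square$; (L2) for every variable $x$, context $C$ and position $p$ of $C$, $C[x]_p\in\mathbb L$ if and only if $C[\square]_p\in\mathbb L$; (L3) if $L,N\in\mathbb L$, $p\in\mathrm{Pos}_{\mathcal F}(L)$ and $L|_p\sqcup N$ is defined, then $L[L|_p\sqcup N]_p\in\mathbb L$. Then every term $t$ has a unique max-top $M$, and $M\ne\square$. Writing $t=M[t_1,\dots,t_n]$, put $\mathrm{rank}(t)=1+\max\{\mathrm{rank}(t_i)\mid 1\le i\le n\}$, where $\max\varnothing=0$. A TRS $\mathcal R$ is \emph{weakly layered} according to the layer system $\mathbb L$ if for each rule $\ell\to r$ of $\mathcal R$: whenever $M$ is the max-top of a term $s$, $p\in\mathrm{Pos}_{\mathcal F}(M)$ and $s\to_{p,\ell\to r}t$, then $M\to_{p,\ell\to r}L$ for some $L\in\mathbb L$. $\mathcal R$ is \emph{bounded duplicating} if, for a fresh unary symbol $\Diamond$, the relation $\to_{\mathcal R}^*\cdot\to_{\{\Diamond(x)\to x\}}\cdot\to_{\mathcal R}^*$ on the terms over $\mathcal F\cup\{\Diamond\}$ is terminating. $\mathcal R$ is \emph{non-duplicating} if for no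 rule $\ell\to r$ of $\mathcal R$ does a variable occur more often in $r$ than in $\ell$. \textbf{Theorem.} Let $\mathcal R$ be a TRS that is weakly layered according to a layer system $\mathbb L$ and confluent on the set of terms of rank one. If $\mathcal R$ is bounded duplicating, then $\mathcal R$ is confluent. In particular this covers non-duplicating systems: if $\mathcal R$ is non-duplicating, then $\mathcal R$ is bounded duplicating, and hence confluent. -/

import Mathlib

universe u v

namespace LayerTRS

/-- A signature: a set of function symbols, each with a fixed arity. -/
structure Signature where
  Sym : Type u
  arity : Sym → ℕ

/-- The signature extended by one fresh symbol `none` of arity `k`. -/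
def Signature.adjoin (S : Signature.{u}) (k : ℕ) : Signature.{u} where
  Sym := Option S.Sym
  arity f := f.elim k S.arity

/-- First-order terms over the signature `S` and the variables `V`. -/
inductive Term (S : Signature.{u}) (V : Type v) : Type (max u v)
  | var (x : V) : Term S V
  | app (f : S.Sym) (ts : Fin (S.arity f) → Term S V) : Term S V

namespace Term

variable {S : Signature.{u}} {V : Type v}

/-- The set of variables of a term. -/
def vars : Term S V → Set V
  | var x => {x}
  | app _ ts => ⋃ i, (ts i).vars

open Classical in
/-- The number of occurrences of the variable `x` in a term. -/
noncomputable def countVar (x : V) : Term S V → ℕ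
  | var y => if y = x then 1 else 0
  | app _ ts => ∑ i, (ts i).countVar x

/-- The number of symbols of a term. -/
def size : Term S V → ℕ
  | var _ => 1
  | app _ ts => 1 + ∑ i, (ts i).size

/-- Application of a substitution. -/
def subst (σ : V → Term S V) : Term S V → Term S V
  | var x => σ x
  | app f ts => app f fun i => (ts i).subst σ

/-- The subterm at a position, if the position exists. Positions are strings of argument indices,
counted from `0`; the empty string is the root. -/
def subtermAt : Term S V → List ℕ → Option (Term S V)
  | t, [] => some t
  | var _, _ :: _ => none
  | app f ts, i :: p => if h : i < S.arity f then (ts ⟨i, h⟩).subtermAt p else none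

/-- `p` is a position of `t`. -/
def IsPos (t : Term S V) (p : List ℕ) : Prop := (t.subtermAt p).isSome

/-- Replacement of the subterm at the position `p` of `t` by `s` (used only for positions `p`
of `t`). -/
def replaceAt : Term S V → List ℕ → Term S V → Term S V
  | _, [], s => s
  | var x, _ :: _, _ => var x
  | app f ts, i :: p, s => app f fun j => if j.val = i then (ts j).replaceAt p s else ts j

/-- A term over `S` seen as a term over the signature with one more symbol. -/
def lift (k : ℕ) : Term S V → Term (S.adjoin k) V
  | var x => var x
  | app f ts => app (S := S.adjoin k) (some f) fun i => (ts i).lift k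

theorem lift_ne_var {k : ℕ} {t : Term S V} (h : ∀ x, t ≠ var x) (x : V) : t.lift k ≠ var x := by
  cases t with
  | var y => exact absurd rfl (h y)
  | app f ts => intro h'; cases h'

theorem vars_lift (k : ℕ) (t : Term S V) : (t.lift k).vars = t.vars := by
  induction t with
  | var x => rfl
  | app f ts ih => exact Set.iUnion_congr ih

theorem size_pos (t : Term S V) : 0 < t.size := by
  cases t <;> simp [size]

theorem size_subtermAt_le {t u : Term S V} {p : List ℕ} (h : t.subtermAt p = some u) :
    u.size ≤ t.size := by
  induction p generalizing t with
  | nil => cases t <;> simp_all [subtermAt]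
  | cons i p ih =>
    cases t with
    | var x => simp [subtermAt] at h
    | app f ts =>
      simp only [subtermAt] at h
      split at h
      · rename_i hi
        have h1 := ih h
        have h2 : (ts ⟨i, hi⟩).size ≤ ∑ j, (ts j).size :=
          Finset.single_le_sum (f := fun j => (ts j).size) (fun _ _ => Nat.zero_le _)
            (Finset.mem_univ _)
        simp only [size]
        omega
      · simp at h

theorem size_subtermAt_lt {t u : Term S V} {p : List ℕ} (hp : p ≠ [])
    (h : t.subtermAt p = some u) : u.size < t.size := by
  cases p with
  | nil => exact absurd rfl hp
  | cons i p =>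
    cases t with
    | var x => simp [subtermAt] at h
    | app f ts =>
      simp only [subtermAt] at h
      split at h
      · rename_i hi
        have h1 := size_subtermAt_le h
        have h2 : (ts ⟨i, hi⟩).size ≤ ∑ j, (ts j).size :=
          Finset.single_le_sum (f := fun j => (ts j).size) (fun _ _ => Nat.zero_le _)
            (Finset.mem_univ _)
        simp only [size]
        omega
      · simp at h

end Term

/-! ### Rewriting -/

/-- A rewrite rule `lhs → rhs`. -/
structure Rule (S : Signature.{u}) (V : Type v) where
  lhs : Term S V
  rhs : Term S V
  lhs_ne_var : ∀ x, lhs ≠ Term.var x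
  vars_subset : rhs.vars ⊆ lhs.vars

/-- A term rewrite system over `S` and `V`: a set of rewrite rules. -/
abbrev TRS (S : Signature.{u}) (V : Type v) := Set (Rule S V)

/-- A rule over `S` seen as a rule over the signature with one more symbol. -/
def Rule.lift {S : Signature.{u}} {V : Type v} (k : ℕ) (ρ : Rule S V) : Rule (S.adjoin k) V where
  lhs := ρ.lhs.lift k
  rhs := ρ.rhs.lift k
  lhs_ne_var := Term.lift_ne_var ρ.lhs_ne_var
  vars_subset := by simpa only [Term.vars_lift] using ρ.vars_subset

variable {S : Signature.{u}} {V : Type v}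

/-- A TRS over `S` seen as a TRS over the signature with one more symbol. -/
def TRS.lift (k : ℕ) (R : TRS S V) : TRS (S.adjoin k) V := Rule.lift k '' R

/-- `s` rewrites to `t` by the rule `ρ` at the position `p`. -/
def StepAt (ρ : Rule S V) (p : List ℕ) (s t : Term S V) : Prop :=
  ∃ σ : V → Term S V,
    s.subtermAt p = some (ρ.lhs.subst σ) ∧ t = s.replaceAt p (ρ.rhs.subst σ)

/-- The rewrite relation of a TRS. -/
def TRS.Step (R : TRS S V) (s t : Term S V) : Prop := ∃ ρ ∈ R, ∃ p, StepAt ρ p s t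

/-- Confluence of a relation: `←* · →* ⊆ →* · ←*`. -/
def Confluent {α : Type*} (r : α → α → Prop) : Prop :=
  ∀ a b c, Relation.ReflTransGen r a b → Relation.ReflTransGen r a c →
    Relation.Join (Relation.ReflTransGen r) b c

/-- `r` is confluent on `A`: `A` is closed under `r`, and the restriction of `r` to `A` is
confluent. -/
def ConfluentOn {α : Type*} (r : α → α → Prop) (A : Set α) : Prop :=
  (∀ a b, a ∈ A → r a b → b ∈ A) ∧ Confluent fun a b => r a b ∧ a ∈ A ∧ b ∈ A

/-- Termination of a relation: there is no infinite sequence `a₀ → a₁ → ⋯`. -/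
def Terminating {α : Type*} (r : α → α → Prop) : Prop :=
  WellFounded fun b a => Relation.TransGen r a b

/-- The relative rewrite relation `R / R'`, which is `→_{R'}* · →_R · →_{R'}*`. -/
def RelStep (R R' : TRS S V) : Term S V → Term S V → Prop :=
  Relation.Comp (Relation.ReflTransGen R'.Step)
    (Relation.Comp R.Step (Relation.ReflTransGen R'.Step))

/-- The term `◊(t)`, where `◊` is the fresh unary symbol of `S.adjoin 1`. -/
def diamond (t : Term (S.adjoin 1) V) : Term (S.adjoin 1) V :=
  Term.app (S := S.adjoin 1) none fun _ => t

/-- The rule `◊(x) → x`. -/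
def diamondRule (x : V) : Rule (S.adjoin 1) V where
  lhs := diamond (Term.var x)
  rhs := Term.var x
  lhs_ne_var := by intro y h; cases h
  vars_subset := by
    intro y hy
    exact Set.mem_iUnion.2 ⟨⟨0, Nat.one_pos⟩, hy⟩

/-- The TRS `{◊(x) → x}`. As a set of rules it contains a copy of the rule for each name of the
variable `x`; all these copies induce the same rewrite relation. -/
def diamondTRS : TRS (S.adjoin 1) V := Set.range diamondRule

/-- `R` is bounded duplicating: `{◊(x) → x} / R` is terminating, as a relation on the terms over
the signature extended by the fresh unary symbol `◊`. -/
def BoundedDuplicating (R : TRS S V) : Prop :=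
  Terminating (RelStep diamondTRS (R.lift 1))

/-- No rule of `R` is duplicating. -/
def NonDuplicating (R : TRS S V) : Prop :=
  ∀ ρ ∈ R, ∀ x, ρ.rhs.countVar x ≤ ρ.lhs.countVar x

/-! ### Layer systems -/

/-- Contexts with an arbitrary number of holes: terms over the signature extended by a fresh
constant, the hole. -/
abbrev Ctx (S : Signature.{u}) (V : Type v) := Term (S.adjoin 0) V

/-- The hole, which is also the empty context. -/
def hole : Ctx S V := Term.app (S := S.adjoin 0) none fun i => i.elim0

/-- A term as a context without holes. -/
def Term.toCtx (t : Term S V) : Ctx S V := t.lift 0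

/-- The partial order `⊑` on contexts: the least reflexive, transitive and monotone relation with
`□ ⊑ C` for all `C`. -/
inductive Ctx.Le : Ctx S V → Ctx S V → Prop
  | hole_le (C : Ctx S V) : Ctx.Le hole C
  | refl (C : Ctx S V) : Ctx.Le C C
  | trans {C D E : Ctx S V} : Ctx.Le C D → Ctx.Le D E → Ctx.Le C E
  | app (f : (S.adjoin 0).Sym) (Cs Ds : Fin ((S.adjoin 0).arity f) → Ctx S V) :
      (∀ i, Ctx.Le (Cs i) (Ds i)) → Ctx.Le (Term.app f Cs) (Term.app f Ds)

/-- `C ⊔ D` is defined and equal to `E`. -/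
def Ctx.IsMerge (C D E : Ctx S V) : Prop :=
  Ctx.Le C E ∧ Ctx.Le D E ∧ ∀ E', Ctx.Le C E' → Ctx.Le D E' → Ctx.Le E E'

/-- `p` is a position of `C` that carries a function symbol of `S` (neither a variable nor the
hole). -/
def Ctx.IsFunPos (C : Ctx S V) (p : List ℕ) : Prop :=
  ∃ (f : S.Sym) (Cs : Fin (S.arity f) → Ctx S V),
    C.subtermAt p = some (Term.app (S := S.adjoin 0) (some f) Cs)

/-- `L` is a top of `C` according to `𝕃`. -/
def IsTop (𝕃 : Set (Ctx S V)) (L C : Ctx S V) : Prop := L ∈ 𝕃 ∧ Ctx.Le L C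

/-- `M` is a max-top of `C` according to `𝕃`. -/
def IsMaxTop (𝕃 : Set (Ctx S V)) (M C : Ctx S V) : Prop :=
  IsTop 𝕃 M C ∧ ∀ L, IsTop 𝕃 L C → Ctx.Le M L → L = M

/-- `𝕃` is a layer system. -/
structure IsLayerSystem (𝕃 : Set (Ctx S V)) : Prop where
  /-- (L1) -/
  exists_top : ∀ t : Term S V, ∃ L, IsTop 𝕃 L t.toCtx ∧ L ≠ hole
  /-- (L2) -/
  var_iff_hole : ∀ (x : V) (C : Ctx S V) (p : List ℕ), C.IsPos p →
    (C.replaceAt p (Term.var x) ∈ 𝕃 ↔ C.replaceAt p hole ∈ 𝕃)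
  /-- (L3) -/
  merge_mem : ∀ L ∈ 𝕃, ∀ N ∈ 𝕃, ∀ p, Ctx.IsFunPos L p → ∀ C, L.subtermAt p = some C →
    ∀ E, Ctx.IsMerge C N E → L.replaceAt p E ∈ 𝕃

/-- Condition (W): `R` is weakly layered according to the layer system `𝕃`. -/
def WeaklyLayered (R : TRS S V) (𝕃 : Set (Ctx S V)) : Prop :=
  ∀ ρ ∈ R, ∀ (s t : Term S V) (M : Ctx S V) (p : List ℕ),
    IsMaxTop 𝕃 M s.toCtx → Ctx.IsFunPos M p → StepAt ρ p s t →
      ∃ L ∈ 𝕃, StepAt (ρ.lift 0) p M L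

/-- `u` is an alien of `t`: with `M` the max-top of `t` and `t = M[t₁, …, tₙ]`, it is one of the
`tᵢ`. For a layer system the max-top of `t` exists, is unique and is not the hole; requiring
`M ≠ hole` makes aliens smaller than `t` for every set `𝕃`. -/
def IsAlien (𝕃 : Set (Ctx S V)) (u t : Term S V) : Prop :=
  ∃ M p, IsMaxTop 𝕃 M t.toCtx ∧ M ≠ hole ∧ M.subtermAt p = some hole ∧ t.subtermAt p = some u

theorem IsAlien.size_lt {𝕃 : Set (Ctx S V)} {u t : Term S V} (h : IsAlien 𝕃 u t) :
    u.size < t.size := by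
  obtain ⟨M, p, -, hM, hp, hu⟩ := h
  refine Term.size_subtermAt_lt ?_ hu
  rintro rfl
  apply hM
  cases M <;> simpa [Term.subtermAt] using hp

/-- The rank of a term: `1` plus the maximum of the ranks of its (finitely many) aliens, where the
maximum of the empty set is `0`. -/
noncomputable def rank (𝕃 : Set (Ctx S V)) (t : Term S V) : ℕ :=
  1 + sSup {k | ∃ u, ∃ _h : IsAlien 𝕃 u t, k = rank 𝕃 u}
termination_by t.size
decreasing_by exact _h.size_lt

end LayerTRS

/-!
Confluence on the terms of rank at most `r + 1` follows from confluence on the terms of rank at most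
`r`. Decompose a term `s` of rank at most `r + 1` into its aliens of rank `r`, which are put into
boxes, and the rest. A reduction from `s` can be followed on this decomposition, by steps outside
the boxes and steps in their contents, until the reduct has a max-top that makes it necessary to
open a box. As long as no box is opened, replacing each box by a variable that stands for the
joinability class of its content yields a reduction from a term of rank at most `r`, so that two
such reductions are joinable. If each box carries the mark `◊`, then opening a box is a step by the
rule `◊(x) → x`. Since `R` is bounded duplicating, boxes cannot be opened forever, and the reducts
that are reached by opening boxes are handled by well-founded induction.

If `R` is non-duplicating, it is bounded duplicating because the number of the symbols `◊` does not
increase in steps by `R` and decreases in steps by `◊(x) → x`.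
-/

namespace LayerTRS

open Relation (ReflTransGen TransGen ReflGen Join)
variable {S : Signature.{u}} {V : Type v}

section AbstractRewriting

variable {α : Type*} {r : α → α → Prop}

/-- Confluence of `r` for the reductions that start at `a`. -/
def ConfluentAt (r : α → α → Prop) (a : α) : Prop :=
  ∀ b c, ReflTransGen r a b → ReflTransGen r a c → Join (ReflTransGen r) b c

theorem reflTransGen_restrict {A : Set α} (hA : ∀ a b, a ∈ A → r a b → b ∈ A) {a b : α}
    (ha : a ∈ A) (h : ReflTransGen r a b) :
    b ∈ A ∧ ReflTransGen (fun a b => r a b ∧ a ∈ A ∧ b ∈ A) a b := by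
  induction h with
  | refl => exact ⟨ha, .refl⟩
  | tail _ hbc ih => exact ⟨hA _ _ ih.1 hbc, ih.2.tail ⟨hbc, ih.1, hA _ _ ih.1 hbc⟩⟩

theorem confluentOn_iff_forall_confluentAt {A : Set α} (hA : ∀ a b, a ∈ A → r a b → b ∈ A) :
    ConfluentOn r A ↔ ∀ a ∈ A, ConfluentAt r a := by
  have forget {a b : α} (h : ReflTransGen (fun a b => r a b ∧ a ∈ A ∧ b ∈ A) a b) :
      ReflTransGen r a b := ReflTransGen.mono (fun _ _ h => h.1) _ _ h
  constructor
  · intro h a ha b c hb hc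
    obtain ⟨d, hbd, hcd⟩ :=
      h.2 a b c (reflTransGen_restrict hA ha hb).2 (reflTransGen_restrict hA ha hc).2
    exact ⟨d, forget hbd, forget hcd⟩
  · refine fun h => ⟨hA, fun a b c hb hc => ?_⟩
    obtain rfl | ⟨_, ⟨-, ha, -⟩, -⟩ := hb.cases_head
    · exact ⟨c, hc, .refl⟩
    · obtain ⟨d, hbd, hcd⟩ := h a ha b c (forget hb) (forget hc)
      exact ⟨d, (reflTransGen_restrict hA (reflTransGen_restrict hA ha (forget hb)).1 hbd).2,
        (reflTransGen_restrict hA (reflTransGen_restrict hA ha (forget hc)).1 hcd).2⟩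

/-- Joinability under a confluent relation, as an equivalence relation. -/
def Confluent.joinSetoid (h : Confluent r) : Setoid α :=
  ⟨Join (ReflTransGen r), Relation.equivalence_join h⟩

theorem Confluent.exists_common_reducts (h : Confluent r) {F : Set α} (hF : F.Finite) :
    ∃ g : Quotient h.joinSetoid → α, ∀ a ∈ F, ReflTransGen r a (g (Quotient.mk _ a)) := by
  have common : ∀ c : Quotient h.joinSetoid,
      ∃ z, ∀ a ∈ F, Quotient.mk _ a = c → ReflTransGen r a z := by
    intro c
    have : Nonempty {a // Quotient.mk h.joinSetoid a = c} :=
      nonempty_subtype.2 (Quotient.exists_rep c)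
    have directed : Directed (ReflTransGen r)
        (Subtype.val : {a // Quotient.mk h.joinSetoid a = c} → α) := by
      rintro ⟨a, rfl⟩ ⟨b, hb⟩
      obtain ⟨d, hbd, had⟩ := Quotient.exact hb
      exact ⟨⟨d, Quotient.sound ⟨d, .refl, had⟩⟩, had, hbd⟩
    obtain ⟨z, hz⟩ := directed.finite_set_le (hF.preimage Subtype.val_injective.injOn)
    exact ⟨z, fun a ha hac => hz ⟨a, hac⟩ ha⟩
  choose g hg using common
  exact ⟨g, fun a ha => hg _ a ha rfl⟩

end AbstractRewriting

namespace Term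

variable {W X : Type*}

/-- Application of a substitution whose values are terms over other variables. -/
def bind (σ : V → Term S W) : Term S V → Term S W
  | var x => σ x
  | app f ts => app f fun i => (ts i).bind σ

theorem subst_eq_bind (σ : V → Term S V) (t : Term S V) : t.subst σ = t.bind σ := by
  induction t with
  | var x => rfl
  | app f ts ih => exact congrArg (app f) (funext ih)

@[simp]
theorem bind_var (t : Term S V) : t.bind var = t := by
  induction t with
  | var x => rfl
  | app f ts ih => exact congrArg (app f) (funext ih)

theorem bind_bind (σ : V → Term S W) (τ : W → Term S X) (t : Term S V) :
    (t.bind σ).bind τ = t.bind fun x => (σ x).bind τ := by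
  induction t with
  | var x => rfl
  | app f ts ih => exact congrArg (app f) (funext ih)

theorem lift_bind (k : ℕ) (σ : V → Term S W) (t : Term S V) :
    (t.bind σ).lift k = (t.lift k).bind fun x => (σ x).lift k := by
  induction t with
  | var x => rfl
  | app f ts ih => exact congrArg (app (S := S.adjoin k) (some f)) (funext ih)

theorem mem_vars_app {f : S.Sym} {ts : Fin (S.arity f) → Term S V} {x : V} :
    x ∈ (app f ts).vars ↔ ∃ i, x ∈ (ts i).vars :=
  Set.mem_iUnion

theorem bind_congr {σ τ : V → Term S W} {t : Term S V} (h : ∀ x ∈ t.vars, σ x = τ x) :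
    t.bind σ = t.bind τ := by
  induction t with
  | var x => exact h x rfl
  | app f ts ih =>
    exact congrArg (app f) (funext fun i => ih i fun x hx => h x (mem_vars_app.2 ⟨i, hx⟩))

theorem mem_vars_bind {σ : V → Term S W} {t : Term S V} {y : W} :
    y ∈ (t.bind σ).vars ↔ ∃ x ∈ t.vars, y ∈ (σ x).vars := by
  induction t with
  | var x => simp [bind, vars]
  | app f ts ih =>
    simp only [bind, mem_vars_app, ih]
    tauto

theorem finite_vars (t : Term S V) : t.vars.Finite := by
  induction t with
  | var x => exact Set.finite_singleton x
  | app f ts ih => exact Set.finite_iUnion ih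

theorem bind_app_update (σ : V → Term S W) (f : S.Sym) (ts : Fin (S.arity f) → Term S V)
    (i : Fin (S.arity f)) (s : Term S V) : (app f (Function.update ts i s)).bind σ =
      app f (Function.update (fun j => (ts j).bind σ) i (s.bind σ)) :=
  congrArg (app f) (funext fun j => Function.apply_update (fun _ => bind σ) ts i s j)

theorem lift_app_update (k : ℕ) (f : S.Sym) (ts : Fin (S.arity f) → Term S V)
    (i : Fin (S.arity f)) (s : Term S V) : (app f (Function.update ts i s)).lift k =
      app (S := S.adjoin k) (some f) (Function.update (fun j => (ts j).lift k) i (s.lift k)) :=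
  congrArg (app (S := S.adjoin k) (some f))
    (funext fun j => Function.apply_update (fun _ => lift k) ts i s j)

section Positions

@[simp]
theorem subtermAt_nil (t : Term S V) : t.subtermAt [] = some t := by
  cases t <;> rfl

@[simp]
theorem replaceAt_nil (t s : Term S V) : t.replaceAt [] s = s := by
  cases t <;> rfl

@[simp]
theorem subtermAt_app_cons (f : S.Sym) (ts : Fin (S.arity f) → Term S V) (i : Fin (S.arity f))
    (p : List ℕ) : (app f ts).subtermAt (i :: p) = (ts i).subtermAt p := by
  simp [subtermAt]

@[simp]
theorem replaceAt_app_cons (f : S.Sym) (ts : Fin (S.arity f) → Term S V) (i : Fin (S.arity f))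
    (p : List ℕ) (s : Term S V) : (app f ts).replaceAt (i :: p) s =
      app f (Function.update ts i ((ts i).replaceAt p s)) := by
  simp only [replaceAt, app.injEq, heq_eq_eq, true_and]
  funext j
  by_cases hj : j = i
  · simp [hj]
  · simp [hj, Fin.val_inj]

@[elab_as_elim]
theorem subtermAt_induction {u : Term S V}
    {motive : (t : Term S V) → (p : List ℕ) → t.subtermAt p = some u → Prop}
    (nil : motive u [] (subtermAt_nil u))
    (cons : ∀ f ts (i : Fin (S.arity f)) p (h : (ts i).subtermAt p = some u), motive (ts i) p h →
      motive (app f ts) (i :: p) ((subtermAt_app_cons f ts i p).trans h))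
    (t : Term S V) (p : List ℕ) (h : t.subtermAt p = some u) : motive t p h := by
  induction p generalizing t with
  | nil =>
    obtain rfl : t = u := by simpa using h
    exact nil
  | cons i p ih =>
    cases t with
    | var x => simp [subtermAt] at h
    | app f ts =>
      have hi : i < S.arity f := by
        by_contra hi
        simp [subtermAt, hi] at h
      exact cons f ts ⟨i, hi⟩ p (by simpa [subtermAt, hi] using h) (ih _ _)

variable {t u : Term S V} {p : List ℕ}

theorem subtermAt_append (q : List ℕ) (h : t.subtermAt p = some u) :
    t.subtermAt (p ++ q) = u.subtermAt q := by
  induction t, p, h using subtermAt_induction with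
  | nil => rfl
  | cons f ts i p h ih => simpa using ih

theorem subtermAt_replaceAt (s : Term S V) (h : t.subtermAt p = some u) :
    (t.replaceAt p s).subtermAt p = some s := by
  induction t, p, h using subtermAt_induction with
  | nil => simp
  | cons f ts i p h ih => simpa using ih

theorem replaceAt_self (h : t.subtermAt p = some u) : t.replaceAt p u = t := by
  induction t, p, h using subtermAt_induction with
  | nil => simp
  | cons f ts i p _ ih => simp [ih]

theorem replaceAt_append (q : List ℕ) (s : Term S V) (h : t.subtermAt p = some u) :
    t.replaceAt (p ++ q) s = t.replaceAt p (u.replaceAt q s) := by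
  induction t, p, h using subtermAt_induction with
  | nil => simp
  | cons f ts i p _ ih => simp [ih]

theorem subtermAt_bind (σ : V → Term S W) (h : t.subtermAt p = some u) :
    (t.bind σ).subtermAt p = some (u.bind σ) := by
  induction t, p, h using subtermAt_induction with
  | nil => simp
  | cons f ts i p h ih => simpa [bind] using ih

theorem replaceAt_bind (σ : V → Term S W) (s : Term S V) (h : t.subtermAt p = some u) :
    (t.replaceAt p s).bind σ = (t.bind σ).replaceAt p (s.bind σ) := by
  induction t, p, h using subtermAt_induction with
  | nil => simp
  | cons f ts i p h ih =>
    rw [replaceAt_app_cons, bind_app_update, ih]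
    exact (replaceAt_app_cons ..).symm

theorem subtermAt_lift (k : ℕ) (h : t.subtermAt p = some u) :
    (t.lift k).subtermAt p = some (u.lift k) := by
  induction t, p, h using subtermAt_induction with
  | nil => simp
  | cons f ts i p _ ih =>
    exact (subtermAt_app_cons (S := S.adjoin k) (some f) (fun j => (ts j).lift k) i p).trans ih

theorem replaceAt_lift (k : ℕ) (s : Term S V) (h : t.subtermAt p = some u) :
    (t.replaceAt p s).lift k = (t.lift k).replaceAt p (s.lift k) := by
  induction t, p, h using subtermAt_induction with
  | nil => simp
  | cons f ts i p h ih =>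
    rw [replaceAt_app_cons, lift_app_update, ih]
    exact (replaceAt_app_cons (S := S.adjoin k) (some f) ..).symm

theorem exists_subtermAt_of_mem_vars {x : V} (h : x ∈ t.vars) :
    ∃ p, t.subtermAt p = some (var x) := by
  induction t with
  | var y =>
    obtain rfl : x = y := h
    exact ⟨[], rfl⟩
  | app f ts ih =>
    obtain ⟨i, hi⟩ := mem_vars_app.1 h
    obtain ⟨p, hp⟩ := ih i hi
    exact ⟨i :: p, by simpa using hp⟩

theorem vars_subset_of_subtermAt (h : t.subtermAt p = some u) : u.vars ⊆ t.vars := by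
  induction t, p, h using subtermAt_induction with
  | nil => rfl
  | cons f ts i _ _ ih => exact ih.trans (Set.subset_iUnion (fun j => (ts j).vars) i)

theorem subtermAt_bind_cases {σ : V → Term S W} {u : Term S W}
    (h : (t.bind σ).subtermAt p = some u) :
    (∃ f ts, t.subtermAt p = some (app f ts)) ∨
      ∃ q q' x, p = q ++ q' ∧ t.subtermAt q = some (var x) ∧ (σ x).subtermAt q' = some u := by
  induction t generalizing p with
  | var x => exact .inr ⟨[], p, x, rfl, rfl, h⟩
  | app f ts ih =>
    generalize ht : (app f ts).bind σ = t' at h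
    induction t', p, h using subtermAt_induction with
    | nil => exact .inl ⟨f, ts, rfl⟩
    | cons g ts' i p h =>
      obtain ⟨rfl, h'⟩ := Term.app.inj ht
      obtain rfl := eq_of_heq h'
      rcases ih i h with ⟨g, us, hp⟩ | ⟨q, q', x, rfl, hq, hq'⟩
      · exact .inl ⟨g, us, by simpa using hp⟩
      · exact .inr ⟨i :: q, q', x, rfl, by simpa using hq, hq'⟩

end Positions

end Term

/-! ### Closure under contexts -/

section ContextClosure

variable {W X : Type*}

/-- `T` is closed under contexts, one function symbol at a time. -/
def ContextClosed (T : Term S W → Term S W → Prop) : Prop :=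
  ∀ (f : S.Sym) (ts : Fin (S.arity f) → Term S W) (i : Fin (S.arity f)) (s t : Term S W), T s t →
    T (.app f (Function.update ts i s)) (.app f (Function.update ts i t))

/-- The least relation that contains `r` and is closed under contexts. -/
inductive ContextClosure (r : Term S W → Term S W → Prop) : Term S W → Term S W → Prop
  | of {s t : Term S W} : r s t → ContextClosure r s t
  | app (f : S.Sym) (ts : Fin (S.arity f) → Term S W) (i : Fin (S.arity f)) {s t : Term S W} :
      ContextClosure r s t →
        ContextClosure r (.app f (Function.update ts i s)) (.app f (Function.update ts i t))

variable {r T : Term S W → Term S W → Prop}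

theorem contextClosed_contextClosure (r : Term S W → Term S W → Prop) :
    ContextClosed (ContextClosure r) :=
  fun f ts i _ _ => .app f ts i

theorem ContextClosed.contextClosure_le (hT : ContextClosed T) (h : r ≤ T) :
    ContextClosure r ≤ T := by
  intro s t hst
  induction hst with
  | of hst => exact h _ _ hst
  | app f ts i _ ih => exact hT f ts i _ _ ih

theorem ContextClosure.mono {r' : Term S W → Term S W → Prop} (h : r ≤ r') :
    ContextClosure r ≤ ContextClosure r' :=
  (contextClosed_contextClosure r').contextClosure_le fun _ _ hst => .of (h _ _ hst)

theorem ContextClosed.reflTransGen (hT : ContextClosed T) : ContextClosed (ReflTransGen T) :=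
  fun f ts i _ _ h => h.lift (fun u => Term.app f (Function.update ts i u)) (hT f ts i)

theorem ContextClosed.comp {T' : Term S W → Term S W → Prop} (hT : ContextClosed T)
    (hT' : ContextClosed T') : ContextClosed (Relation.Comp T T') :=
  fun f ts i _ _ ⟨_, h, h'⟩ => ⟨_, hT f ts i _ _ h, hT' f ts i _ _ h'⟩

theorem ContextClosed.comap_bind {T : Term S X → Term S X → Prop} (hT : ContextClosed T)
    (σ : W → Term S X) : ContextClosed fun s t => T (s.bind σ) (t.bind σ) := by
  intro f ts i s t h
  simpa only [Term.bind_app_update] using hT f _ i _ _ h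

theorem ContextClosed.comap_lift {k : ℕ} {T : Term (S.adjoin k) W → Term (S.adjoin k) W → Prop}
    (hT : ContextClosed T) : ContextClosed fun s t => T (s.lift k) (t.lift k) := by
  intro f ts i s t h
  simpa only [Term.lift_app_update] using hT (some f) _ i _ _ h

theorem contextClosed_vars {q : W → W → Prop} (hq : ∀ x, q x x) :
    ContextClosed (S := S) fun s t => ∀ y ∈ t.vars, ∃ x ∈ s.vars, q x y := by
  intro f ts i s t h y hy
  obtain ⟨j, hj⟩ := Term.mem_vars_app.1 hy
  obtain rfl | hji := eq_or_ne j i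
  · obtain ⟨x, hx, hxy⟩ := h y (by simpa using hj)
    exact ⟨x, Term.mem_vars_app.2 ⟨j, by simpa using hx⟩, hxy⟩
  · rw [Function.update_of_ne hji] at hj
    exact ⟨y, Term.mem_vars_app.2 ⟨j, by simpa [hji] using hj⟩, hq y⟩

theorem contextClosure_iff_subtermAt {s t : Term S W} :
    ContextClosure r s t ↔
      ∃ p u v, s.subtermAt p = some u ∧ r u v ∧ t = s.replaceAt p v := by
  constructor
  · intro h
    induction h with
    | of h => exact ⟨[], _, _, Term.subtermAt_nil _, h, (Term.replaceAt_nil _ _).symm⟩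
    | app f ts i _ ih =>
      obtain ⟨p, u, v, hu, huv, rfl⟩ := ih
      exact ⟨i :: p, u, v, by simpa using hu, huv, by simp⟩
  · rintro ⟨p, u, v, hu, huv, rfl⟩
    induction s, p, hu using Term.subtermAt_induction with
    | nil => simpa using ContextClosure.of huv
    | cons f ts i p hu ih => simpa using ContextClosure.app f ts i ih

theorem ContextClosed.reflTransGen_app (hT : ContextClosed T) (f : S.Sym)
    {ts ts' : Fin (S.arity f) → Term S W} (h : ∀ i, ReflTransGen T (ts i) (ts' i)) :
    ReflTransGen T (.app f ts) (.app f ts') := by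
  suffices ∀ F : Finset (Fin (S.arity f)),
      ReflTransGen T (.app f ts) (.app f (F.piecewise ts' ts)) by
    simpa using this Finset.univ
  intro F
  induction F using Finset.induction_on with
  | empty => simpa using ReflTransGen.refl
  | insert i F hi ih =>
    have step := hT.reflTransGen f (F.piecewise ts' ts) i _ _ (h i)
    rw [← Finset.piecewise_insert,
      Function.update_eq_self_iff.2 (Finset.piecewise_eq_of_notMem _ _ _ hi).symm] at step
    exact ih.trans step

theorem ContextClosed.reflTransGen_bind {T : Term S X → Term S X → Prop} (hT : ContextClosed T)
    {σ τ : W → Term S X} {t : Term S W} (h : ∀ x ∈ t.vars, ReflTransGen T (σ x) (τ x)) :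
    ReflTransGen T (t.bind σ) (t.bind τ) := by
  induction t with
  | var x => exact h x rfl
  | app f ts ih =>
    exact hT.reflTransGen_app f fun i =>
      ih i fun x hx => h x (Term.mem_vars_app.2 ⟨i, hx⟩)

end ContextClosure

/-! ### Rewriting over arbitrary variables -/

section Rewrite

variable {W X : Type*} {R : TRS S V}

/-- A rewrite step at the root. The variables of the terms need not be those of the rules, so that
the boxes of a decomposition can be treated as variables. -/
def TRS.RootStep (R : TRS S V) (s t : Term S W) : Prop :=
  ∃ ρ ∈ R, ∃ σ, s = ρ.lhs.bind σ ∧ t = ρ.rhs.bind σ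

/-- The rewrite relation of `R` on terms whose variables need not be those of the rules. -/
def TRS.Rewrite (R : TRS S V) : Term S W → Term S W → Prop :=
  ContextClosure R.RootStep

theorem step_eq_rewrite (R : TRS S V) : R.Step = R.Rewrite := by
  ext s t
  simp only [TRS.Step, StepAt, TRS.Rewrite, contextClosure_iff_subtermAt, TRS.RootStep,
    Term.subst_eq_bind]
  constructor
  · rintro ⟨ρ, hρ, p, σ, hs, rfl⟩
    exact ⟨p, _, _, hs, ⟨ρ, hρ, σ, rfl, rfl⟩, rfl⟩
  · rintro ⟨p, _, _, hs, ⟨ρ, hρ, σ, rfl, rfl⟩, rfl⟩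
    exact ⟨ρ, hρ, p, σ, hs, rfl⟩

theorem contextClosed_rewrite (R : TRS S V) : ContextClosed (R.Rewrite (W := W)) :=
  contextClosed_contextClosure _

theorem TRS.RootStep.bind {s t : Term S W} (h : R.RootStep s t) (σ : W → Term S X) :
    R.RootStep (s.bind σ) (t.bind σ) := by
  obtain ⟨ρ, hρ, τ, rfl, rfl⟩ := h
  exact ⟨ρ, hρ, _, Term.bind_bind .., Term.bind_bind ..⟩

theorem TRS.RootStep.lift {s t : Term S W} (h : R.RootStep s t) (k : ℕ) :
    (R.lift k).RootStep (s.lift k) (t.lift k) := by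
  obtain ⟨ρ, hρ, σ, rfl, rfl⟩ := h
  exact ⟨ρ.lift k, ⟨ρ, hρ, rfl⟩, _, Term.lift_bind .., Term.lift_bind ..⟩

theorem TRS.RootStep.vars_subset {s t : Term S W} (h : R.RootStep s t) : t.vars ⊆ s.vars := by
  obtain ⟨ρ, -, σ, rfl, rfl⟩ := h
  intro y hy
  obtain ⟨x, hx, hy⟩ := Term.mem_vars_bind.1 hy
  exact Term.mem_vars_bind.2 ⟨x, ρ.vars_subset hx, hy⟩

theorem TRS.Rewrite.bind {s t : Term S W} (h : R.Rewrite s t) (σ : W → Term S X) :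
    R.Rewrite (s.bind σ) (t.bind σ) :=
  ((contextClosed_rewrite R).comap_bind σ).contextClosure_le (fun _ _ h => .of (h.bind σ)) _ _ h

theorem TRS.Rewrite.lift {s t : Term S W} (h : R.Rewrite s t) (k : ℕ) :
    (R.lift k).Rewrite (s.lift k) (t.lift k) :=
  (contextClosed_rewrite (R.lift k)).comap_lift.contextClosure_le
    (fun _ _ h => .of (h.lift k)) _ _ h

theorem TRS.Rewrite.vars_subset {s t : Term S W} (h : R.Rewrite s t) : t.vars ⊆ s.vars := by
  have closed := contextClosed_vars (S := S) (q := @Eq W) fun _ => rfl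
  refine fun y hy => ?_
  obtain ⟨x, hx, rfl⟩ := closed.contextClosure_le
    (fun _ _ hr y hy => ⟨y, hr.vars_subset hy, rfl⟩) _ _ h y hy
  exact hx

theorem reflTransGen_rewrite_bind {s t : Term S W} (h : ReflTransGen R.Rewrite s t)
    (σ : W → Term S X) : ReflTransGen R.Rewrite (s.bind σ) (t.bind σ) :=
  h.lift (Term.bind σ) fun _ _ h => h.bind σ

theorem vars_subset_of_reflTransGen {s t : Term S W} (h : ReflTransGen R.Rewrite s t) :
    t.vars ⊆ s.vars := by
  induction h with
  | refl => rfl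
  | tail _ h ih => exact h.vars_subset.trans ih

theorem confluentAt_of_rename [Infinite V] [Nonempty X] {s : Term S X}
    (h : ∀ f : X → V, ConfluentAt R.Rewrite (s.bind fun x => .var (f x))) :
    ConfluentAt R.Rewrite s := by
  obtain ⟨f, -, hf⟩ := s.finite_vars.exists_injOn_of_encard_le (t := (Set.univ : Set V))
    (by simp [Set.infinite_univ.encard_eq])
  let undo : V → Term S X := fun y => .var (Function.invFunOn f s.vars y)
  have undo_rename : ∀ {t}, ReflTransGen R.Rewrite s t →
      (t.bind fun x => .var (f x)).bind undo = t := by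
    intro t ht
    calc (t.bind fun x => .var (f x)).bind undo
        = t.bind fun x => .var (Function.invFunOn f s.vars (f x)) := Term.bind_bind ..
      _ = t.bind .var := Term.bind_congr fun x hx =>
          congrArg Term.var (hf.leftInvOn_invFunOn (vars_subset_of_reflTransGen ht hx))
      _ = t := Term.bind_var t
  intro b c hb hc
  obtain ⟨d, hbd, hcd⟩ := h f _ _ (reflTransGen_rewrite_bind hb _) (reflTransGen_rewrite_bind hc _)
  refine ⟨d.bind undo, ?_, ?_⟩
  · simpa only [undo_rename hb] using reflTransGen_rewrite_bind hbd undo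
  · simpa only [undo_rename hc] using reflTransGen_rewrite_bind hcd undo

end Rewrite

/-! ### The order on contexts -/

namespace Ctx

open Term

/-- The context `f(C₁, …, Cₙ)` for a function symbol `f` of `S`, that is, not the hole. -/
abbrev node (f : S.Sym) (Cs : Fin (S.arity f) → Ctx S V) : Ctx S V :=
  Term.app (S := S.adjoin 0) (some f) Cs

theorem app_none_eq_hole (ts : Fin ((S.adjoin 0).arity none) → Ctx S V) :
    Term.app (S := S.adjoin 0) none ts = hole :=
  congrArg (Term.app (S := S.adjoin 0) none) (funext fun i => i.elim0)

@[elab_as_elim]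
theorem induction {motive : Ctx S V → Prop} (hole : motive hole) (var : ∀ x, motive (var x))
    (node : ∀ f Cs, (∀ i, motive (Cs i)) → motive (node f Cs)) (C : Ctx S V) : motive C := by
  induction C with
  | var x => exact var x
  | app f Cs ih =>
    match f, Cs, ih with
    | none, Cs, _ => rw [app_none_eq_hole]; exact hole
    | some f, Cs, ih => exact node f Cs ih

theorem node_le_node {f : S.Sym} {Cs Ds : Fin (S.arity f) → Ctx S V}
    (h : ∀ i, Ctx.Le (Cs i) (Ds i)) : Ctx.Le (node f Cs) (node f Ds) :=
  .app (some f) Cs Ds h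

theorem eq_var_of_var_le {x : V} {D : Ctx S V} (h : Ctx.Le (var x) D) : D = var x := by
  generalize hC : (var x : Ctx S V) = C at h
  induction h with
  | hole_le => cases hC
  | refl => rfl
  | trans _ _ ihCD ihDE => rw [ihDE (ihCD hC ▸ hC), ihCD hC]
  | app => cases hC

theorem exists_of_node_le {f : S.Sym} {Cs : Fin (S.arity f) → Ctx S V} {D : Ctx S V}
    (h : Ctx.Le (node f Cs) D) :
    ∃ Ds : Fin (S.arity f) → Ctx S V, D = node f Ds ∧ ∀ i, Ctx.Le (Cs i) (Ds i) := by
  generalize hC : node f Cs = C at h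
  induction h generalizing Cs with
  | hole_le => cases hC
  | refl => exact ⟨Cs, hC.symm, fun i => .refl _⟩
  | trans _ _ ihCD ihDE =>
    obtain ⟨Ds, rfl, hCD⟩ := ihCD hC
    obtain ⟨Es, rfl, hDE⟩ := ihDE rfl
    exact ⟨Es, rfl, fun i => (hCD i).trans (hDE i)⟩
  | app g As Bs h =>
    cases hC
    exact ⟨Bs, rfl, h⟩

theorem eq_hole_of_le_hole {C : Ctx S V} (h : Ctx.Le C hole) : C = hole := by
  induction C using Ctx.induction with
  | hole => rfl
  | var x => exact (eq_var_of_var_le h).symm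
  | node f Cs =>
    obtain ⟨Ds, hD, -⟩ := exists_of_node_le h
    cases hD

theorem eq_hole_or_eq_var_of_le_var {C : Ctx S V} {x : V} (h : Ctx.Le C (var x)) :
    C = hole ∨ C = var x := by
  induction C using Ctx.induction with
  | hole => exact .inl rfl
  | var y => exact .inr (eq_var_of_var_le h).symm
  | node f Cs =>
    obtain ⟨Ds, hD, -⟩ := exists_of_node_le h
    cases hD

theorem eq_hole_or_exists_of_le_node {C : Ctx S V} {f : S.Sym} {Ds : Fin (S.arity f) → Ctx S V}
    (h : Ctx.Le C (node f Ds)) :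
    C = hole ∨ ∃ Cs : Fin (S.arity f) → Ctx S V, C = node f Cs ∧ ∀ i, Ctx.Le (Cs i) (Ds i) := by
  induction C using Ctx.induction with
  | hole => exact .inl rfl
  | var y => cases eq_var_of_var_le h
  | node g Cs =>
    obtain ⟨Es, hE, hCE⟩ := exists_of_node_le h
    cases hE
    exact .inr ⟨Cs, rfl, hCE⟩

theorem le_antisymm {C D : Ctx S V} (hCD : Ctx.Le C D) (hDC : Ctx.Le D C) : C = D := by
  induction C using Ctx.induction generalizing D with
  | hole => exact (eq_hole_of_le_hole hDC).symm
  | var x => exact (eq_var_of_var_le hCD).symm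
  | node f Cs ih =>
    obtain ⟨Ds, rfl, hCsDs⟩ := exists_of_node_le hCD
    obtain ⟨Es, hE, hDsEs⟩ := exists_of_node_le hDC
    cases hE
    exact congrArg (node f) (funext fun i => ih i (hCsDs i) (hDsEs i))

instance : IsTrans (Ctx S V) Ctx.Le := ⟨fun _ _ _ => .trans⟩

theorem exists_merge {C D T : Ctx S V} (hC : Ctx.Le C T) (hD : Ctx.Le D T) :
    ∃ E, Ctx.IsMerge C D E := by
  induction T using Ctx.induction generalizing C D with
  | hole =>
    rw [eq_hole_of_le_hole hC, eq_hole_of_le_hole hD]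
    exact ⟨hole, .refl _, .refl _, fun _ h _ => h⟩
  | var x =>
    obtain rfl | rfl := eq_hole_or_eq_var_of_le_var hC
    · exact ⟨D, .hole_le _, .refl _, fun _ _ h => h⟩
    · exact ⟨_, .refl _, hD, fun _ h _ => h⟩
  | node f Ts ih =>
    obtain rfl | ⟨Cs, rfl, hCs⟩ := eq_hole_or_exists_of_le_node hC
    · exact ⟨D, .hole_le _, .refl _, fun _ _ h => h⟩
    obtain rfl | ⟨Ds, rfl, hDs⟩ := eq_hole_or_exists_of_le_node hD
    · exact ⟨_, .refl _, .hole_le _, fun _ h _ => h⟩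
    choose Es hCE hDE hmin using fun i => ih i (hCs i) (hDs i)
    refine ⟨node f Es, node_le_node hCE, node_le_node hDE, fun E' hC' hD' => ?_⟩
    obtain ⟨Es', rfl, hCE'⟩ := exists_of_node_le hC'
    obtain ⟨Es'', hE'', hDE'⟩ := exists_of_node_le hD'
    cases hE''
    exact node_le_node fun i => hmin i _ (hCE' i) (hDE' i)

theorem finite_setOf_le (T : Ctx S V) : {C | Ctx.Le C T}.Finite := by
  induction T using Ctx.induction with
  | hole => exact (Set.finite_singleton hole).subset fun _ => eq_hole_of_le_hole
  | var x => exact (Set.toFinite {hole, var x}).subset fun _ => eq_hole_or_eq_var_of_le_var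
  | node f Ts ih =>
    refine (((Set.Finite.pi' ih).image (node f)).insert hole).subset fun C hC => ?_
    obtain rfl | ⟨Cs, rfl, h⟩ := eq_hole_or_exists_of_le_node hC
    · exact .inl rfl
    · exact .inr ⟨Cs, h, rfl⟩

theorem exists_of_app_le {f : (S.adjoin 0).Sym} (i : Fin ((S.adjoin 0).arity f))
    {Cs : Fin ((S.adjoin 0).arity f) → Ctx S V} {D : Ctx S V} (h : Ctx.Le (app f Cs) D) :
    ∃ Ds : Fin ((S.adjoin 0).arity f) → Ctx S V, D = app f Ds ∧ ∀ j, Ctx.Le (Cs j) (Ds j) :=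
  match f, i with
  | some _, _ => exists_of_node_le h

theorem le_subtermAt {C D A B : Ctx S V} {p : List ℕ} (h : Ctx.Le C D)
    (hA : C.subtermAt p = some A) (hB : D.subtermAt p = some B) : Ctx.Le A B := by
  induction C, p, hA using subtermAt_induction generalizing D with
  | nil =>
    obtain rfl : D = B := by simpa using hB
    exact h
  | cons f Cs i p _ ih =>
    obtain ⟨Ds, rfl, hCD⟩ := exists_of_app_le i h
    exact ih (hCD i) (by simpa using hB)

theorem replaceAt_le {C D A B E : Ctx S V} {p : List ℕ} (h : Ctx.Le C D)
    (hA : C.subtermAt p = some A) (hB : D.subtermAt p = some B) (hE : Ctx.Le E B) :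
    Ctx.Le (C.replaceAt p E) D := by
  induction C, p, hA using subtermAt_induction generalizing D with
  | nil =>
    obtain rfl : D = B := by simpa using hB
    simpa using hE
  | cons f Cs i p hA ih =>
    obtain ⟨Ds, rfl, hCD⟩ := exists_of_app_le i h
    rw [replaceAt_app_cons]
    refine .app f _ _ fun j => ?_
    obtain rfl | hji := eq_or_ne j i
    · simpa using ih (hCD j) (by simpa using hB)
    · simpa [hji] using hCD j

theorem le_of_bind_le {W : Type*} {l : Term S W} {σ τ : W → Ctx S V}
    (h : Ctx.Le ((l.lift 0).bind σ) ((l.lift 0).bind τ)) {x : W} (hx : x ∈ l.vars) :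
    Ctx.Le (σ x) (τ x) := by
  obtain ⟨p, hp⟩ := exists_subtermAt_of_mem_vars hx
  exact le_subtermAt h (subtermAt_bind σ (subtermAt_lift 0 hp))
    (subtermAt_bind τ (subtermAt_lift 0 hp))

end Ctx

/-! ### Layers and max-tops -/

section MaxTop

variable {𝕃 : Set (Ctx S V)} {L M M' N C : Ctx S V} {t : Term S V}

theorem IsTop.directed (h𝕃 : IsLayerSystem 𝕃) (hL : IsTop 𝕃 L C) (hN : IsTop 𝕃 N C) :
    ∃ E, IsTop 𝕃 E C ∧ Ctx.Le L E ∧ Ctx.Le N E := by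
  induction L using Ctx.induction with
  | hole => exact ⟨N, hN, .hole_le _, .refl _⟩
  | var x =>
    obtain rfl := Ctx.eq_var_of_var_le hL.2
    exact ⟨_, hL, .refl _, hN.2⟩
  | node f Cs =>
    obtain ⟨E, hLE, hNE, hmin⟩ := Ctx.exists_merge hL.2 hN.2
    have hE := h𝕃.merge_mem _ hL.1 N hN.1 [] ⟨f, Cs, Term.subtermAt_nil _⟩ _
      (Term.subtermAt_nil _) E ⟨hLE, hNE, hmin⟩
    exact ⟨E, ⟨by simpa using hE, hmin _ hL.2 hN.2⟩, hLE, hNE⟩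

theorem exists_isMaxTop (h𝕃 : IsLayerSystem 𝕃) (t : Term S V) : ∃ M, IsMaxTop 𝕃 M t.toCtx := by
  have : Nonempty {L // IsTop 𝕃 L t.toCtx} :=
    have ⟨L, hL, _⟩ := h𝕃.exists_top t
    ⟨L, hL⟩
  have directed : Directed Ctx.Le (Subtype.val : {L // IsTop 𝕃 L t.toCtx} → Ctx S V) :=
    fun L N => have ⟨E, hE, hLE, hNE⟩ := L.2.directed h𝕃 N.2; ⟨⟨E, hE⟩, hLE, hNE⟩
  obtain ⟨M, hM⟩ := directed.finite_set_le
    (((Ctx.finite_setOf_le t.toCtx).preimage Subtype.val_injective.injOn))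
  exact ⟨M, M.2, fun L hL hML => Ctx.le_antisymm (hM ⟨L, hL⟩ hL.2) hML⟩

theorem IsMaxTop.greatest (h𝕃 : IsLayerSystem 𝕃) (hM : IsMaxTop 𝕃 M C) (hL : IsTop 𝕃 L C) :
    Ctx.Le L M := by
  obtain ⟨E, hE, hME, hLE⟩ := hM.1.directed h𝕃 hL
  rwa [hM.2 E hE hME] at hLE

theorem IsMaxTop.unique (h𝕃 : IsLayerSystem 𝕃) (hM : IsMaxTop 𝕃 M C) (hM' : IsMaxTop 𝕃 M' C) :
    M = M' :=
  Ctx.le_antisymm (hM'.greatest h𝕃 hM.1) (hM.greatest h𝕃 hM'.1)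

theorem IsMaxTop.ne_hole (h𝕃 : IsLayerSystem 𝕃) (hM : IsMaxTop 𝕃 M t.toCtx) : M ≠ hole := by
  rintro rfl
  obtain ⟨L, hL, hne⟩ := h𝕃.exists_top t
  exact hne (hM.2 L hL (.hole_le _))

/-- The contexts that (L2) allows to exchange for each other: the hole and the variables. -/
def Ctx.IsAtom (C : Ctx S V) : Prop := C = hole ∨ ∃ x, C = .var x

theorem replaceAt_mem_iff_of_isAtom (h𝕃 : IsLayerSystem 𝕃) {A : Ctx S V} (hA : A.IsAtom)
    {p : List ℕ} (hp : C.IsPos p) : C.replaceAt p A ∈ 𝕃 ↔ C.replaceAt p hole ∈ 𝕃 := by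
  obtain rfl | ⟨x, rfl⟩ := hA
  · rfl
  · exact h𝕃.var_iff_hole x C p hp

theorem bind_mem_of_isAtom (h𝕃 : IsLayerSystem 𝕃) {W : Type*} {C : Term (S.adjoin 0) W}
    {σ τ : W → Ctx S V} (hσ : ∀ x, Ctx.IsAtom (σ x)) (hτ : ∀ x, Ctx.IsAtom (τ x))
    (h : C.bind σ ∈ 𝕃) : C.bind τ ∈ 𝕃 := by
  let Exchange : Ctx S V → Ctx S V → Prop :=
    ContextClosure fun A B => Ctx.IsAtom A ∧ Ctx.IsAtom B
  have mem_of_exchange : ∀ {C D}, Exchange C D → C ∈ 𝕃 → D ∈ 𝕃 := by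
    intro C D hCD hC
    obtain ⟨p, A, B, hp, ⟨hA, hB⟩, rfl⟩ := contextClosure_iff_subtermAt.1 hCD
    have hpos : C.IsPos p := by simp [Term.IsPos, hp]
    rw [replaceAt_mem_iff_of_isAtom h𝕃 hB hpos, ← replaceAt_mem_iff_of_isAtom h𝕃 hA hpos,
      Term.replaceAt_self hp]
    exact hC
  have exchanges : ReflTransGen Exchange (C.bind σ) (C.bind τ) :=
    (contextClosed_contextClosure _).reflTransGen_bind fun x _ => .single (.of ⟨hσ x, hτ x⟩)
  exact exchanges.head_induction_on (motive := fun D _ => D ∈ 𝕃 → C.bind τ ∈ 𝕃) id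
    (fun hstep _ ih hD => ih (mem_of_exchange hstep hD)) h

end MaxTop

/-! ### Decompositions of terms -/

/-- A term some of whose subterms are put into boxes. The box with content `u` is the variable
`Sum.inr u`, so that rewriting above the boxes is rewriting with arbitrary variables. -/
abbrev Deco (S : Signature.{u}) (V : Type v) := Term S (V ⊕ Term S V)

namespace Deco

open Term

/-- The term obtained by opening all boxes. -/
def flat (D : Deco S V) : Term S V := D.bind (Sum.elim var id)

/-- The context obtained by replacing all boxes by holes. -/
def ctx (D : Deco S V) : Ctx S V := (D.lift 0).bind (Sum.elim var fun _ => hole)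

/-- A term as a decomposition without boxes. -/
def embed (u : Term S V) : Deco S V := u.bind fun x => var (Sum.inl x)

theorem flat_embed (u : Term S V) : flat (embed u) = u :=
  (bind_bind ..).trans (bind_var u)

theorem subtermAt_ctx {D E : Deco S V} {p : List ℕ} (h : D.subtermAt p = some E) :
    D.ctx.subtermAt p = some E.ctx :=
  subtermAt_bind _ (subtermAt_lift 0 h)

theorem subtermAt_flat {D E : Deco S V} {p : List ℕ} (h : D.subtermAt p = some E) :
    D.flat.subtermAt p = some E.flat :=
  subtermAt_bind _ h

theorem ctx_replaceAt {D F : Deco S V} {p : List ℕ} (E : Deco S V) (h : D.subtermAt p = some F) :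
    ctx (D.replaceAt p E) = D.ctx.replaceAt p E.ctx := by
  rw [ctx, replaceAt_lift 0 E h]
  exact replaceAt_bind _ _ (subtermAt_lift 0 h)

theorem flat_replaceAt {D F : Deco S V} {p : List ℕ} (E : Deco S V)
    (h : D.subtermAt p = some F) : flat (D.replaceAt p E) = D.flat.replaceAt p E.flat :=
  replaceAt_bind _ _ h

theorem ctx_bind {l : Term S V} {υ : V → Deco S V} {τ : V → Ctx S V}
    (h : ∀ x ∈ l.vars, (υ x).ctx = τ x) : ctx (l.bind υ) = (l.lift 0).bind τ := by
  rw [ctx, lift_bind, bind_bind]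
  exact bind_congr fun x hx => h x (vars_lift 0 l ▸ hx)

theorem flat_bind {l : Term S V} {υ : V → Deco S V} {σ : V → Term S V}
    (h : ∀ x ∈ l.vars, (υ x).flat = σ x) : flat (l.bind υ) = l.bind σ :=
  (bind_bind ..).trans (bind_congr h)

theorem ctx_le (D : Deco S V) : Ctx.Le D.ctx D.flat.toCtx := by
  induction D with
  | var x =>
    cases x with
    | inl x => exact .refl _
    | inr u => exact .hole_le _
  | app f Ds ih => exact Ctx.node_le_node ih

theorem exists_of_le {M : Ctx S V} {t : Term S V} (h : Ctx.Le M t.toCtx) :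
    ∃ D : Deco S V, D.ctx = M ∧ D.flat = t := by
  induction t generalizing M with
  | var x =>
    obtain rfl | rfl := Ctx.eq_hole_or_eq_var_of_le_var h
    · exact ⟨var (Sum.inr (var x)), rfl, rfl⟩
    · exact ⟨var (Sum.inl x), rfl, rfl⟩
  | app f ts ih =>
    obtain rfl | ⟨Cs, rfl, hCs⟩ := Ctx.eq_hole_or_exists_of_le_node h
    · exact ⟨var (Sum.inr (app f ts)), rfl, rfl⟩
    · choose Ds hctx hflat using fun i => ih i (hCs i)
      exact ⟨app f Ds, congrArg (Ctx.node f) (funext hctx), congrArg (app f) (funext hflat)⟩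

theorem inr_mem_vars_of_ctx_subtermAt {D : Deco S V} {p : List ℕ} {u : Term S V}
    (hC : D.ctx.subtermAt p = some hole) (hu : D.flat.subtermAt p = some u) :
    Sum.inr u ∈ D.vars := by
  obtain ⟨f, Ds, hD⟩ | ⟨q, q', x, rfl, hq, hq'⟩ := subtermAt_bind_cases hu
  · cases (subtermAt_ctx hD).symm.trans hC
  · rw [subtermAt_append q' (subtermAt_ctx hq)] at hC
    obtain x | w := x
    · cases q' <;> cases hC
    · obtain _ | ⟨i, q'⟩ := q'
      · obtain rfl : w = u := by simpa using hq'
        exact vars_subset_of_subtermAt hq rfl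
      · exact absurd hC (by simp [ctx, lift, Term.bind, hole, subtermAt, Signature.adjoin])

/-- `E` is obtained from `D` by partially opening boxes. -/
inductive Refine : Deco S V → Deco S V → Prop
  | inl (x : V) : Refine (var (Sum.inl x)) (var (Sum.inl x))
  | inr (E : Deco S V) : Refine (var (Sum.inr E.flat)) E
  | app (f : S.Sym) (Ds Es : Fin (S.arity f) → Deco S V) : (∀ i, Refine (Ds i) (Es i)) →
      Refine (app f Ds) (app f Es)

theorem refine_of_ctx_le {D E : Deco S V} (hctx : Ctx.Le D.ctx E.ctx) (hflat : D.flat = E.flat) :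
    Refine D E := by
  induction D generalizing E with
  | var x =>
    cases x with
    | inl x =>
      have hE : E.ctx = var x := Ctx.eq_var_of_var_le hctx
      match E with
      | var (Sum.inl y) => cases hE; exact .inl _
      | var (Sum.inr u) => cases hE
      | app f Es => cases hE
    | inr u =>
      obtain rfl : u = E.flat := hflat
      exact .inr E
  | app f Ds ih =>
    obtain ⟨Cs, hE, hCs⟩ := Ctx.exists_of_node_le hctx
    match E with
    | var (Sum.inl y) => cases hE
    | var (Sum.inr u) => cases hE
    | app g Es =>
      cases hE
      exact .app f Ds Es fun i => ih i (hCs i) (congrFun (eq_of_heq (app.inj hflat).2) i)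

theorem ext_ctx_flat {D E : Deco S V} (hctx : D.ctx = E.ctx) (hflat : D.flat = E.flat) :
    D = E := by
  have h : Refine D E := refine_of_ctx_le (hctx ▸ .refl _) hflat
  clear hflat
  induction h with
  | inl x => rfl
  | inr E =>
    match E with
    | var (Sum.inl x) => cases hctx
    | var (Sum.inr u) => rfl
    | app f Es => cases hctx
  | app f Ds Es _ ih =>
    exact congrArg _ (funext fun i => ih i (congrFun (eq_of_heq (app.inj hctx).2) i))

end Deco

/-! ### Rank -/

section Rank

variable {𝕃 : Set (Ctx S V)}

theorem rank_le_size (𝕃 : Set (Ctx S V)) (t : Term S V) : rank 𝕃 t ≤ t.size := by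
  induction hn : t.size using Nat.strong_induction_on generalizing t with
  | _ n ih =>
    subst hn
    have hsup : sSup {k | ∃ u, ∃ _h : IsAlien 𝕃 u t, k = rank 𝕃 u} ≤ t.size - 1 := by
      refine csSup_le' ?_
      rintro k ⟨u, hu, rfl⟩
      exact (ih u.size hu.size_lt u rfl).trans (Nat.le_sub_one_of_lt hu.size_lt)
    have := t.size_pos
    rw [rank]
    omega

theorem IsAlien.rank_lt {u t : Term S V} (h : IsAlien 𝕃 u t) : rank 𝕃 u < rank 𝕃 t := by
  rw [rank.eq_1 𝕃 t, Nat.lt_one_add_iff]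
  refine le_csSup ⟨t.size, ?_⟩ ⟨u, h, rfl⟩
  rintro k ⟨w, hw, rfl⟩
  exact (rank_le_size 𝕃 w).trans hw.size_lt.le

theorem rank_le_succ_iff {t : Term S V} {k : ℕ} :
    rank 𝕃 t ≤ k + 1 ↔ ∀ u, IsAlien 𝕃 u t → rank 𝕃 u ≤ k := by
  refine ⟨fun h u hu => Nat.lt_succ_iff.1 (hu.rank_lt.trans_le h), fun h => ?_⟩
  rw [rank, add_comm, Nat.add_le_add_iff_right]
  refine csSup_le' ?_
  rintro _ ⟨u, hu, rfl⟩
  exact h u hu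

theorem one_le_rank (𝕃 : Set (Ctx S V)) (t : Term S V) : 1 ≤ rank 𝕃 t := by
  rw [rank]
  omega

end Rank

/-! ### Maximal decompositions -/

section MaxDeco

open Term Deco

variable {𝕃 : Set (Ctx S V)}

theorem exists_deco_isMaxTop (h𝕃 : IsLayerSystem 𝕃) (t : Term S V) :
    ∃ D : Deco S V, IsMaxTop 𝕃 D.ctx t.toCtx ∧ D.flat = t := by
  obtain ⟨M, hM⟩ := exists_isMaxTop h𝕃 t
  obtain ⟨D, rfl, hD⟩ := exists_of_le hM.1.2
  exact ⟨D, hM, hD⟩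

/-- The decomposition of `t` into its max-top and its aliens, each in a box. -/
noncomputable def IsLayerSystem.maxDeco (h𝕃 : IsLayerSystem 𝕃) (t : Term S V) : Deco S V :=
  (exists_deco_isMaxTop h𝕃 t).choose

variable (h𝕃 : IsLayerSystem 𝕃)
include h𝕃

theorem isMaxTop_ctx_maxDeco (t : Term S V) : IsMaxTop 𝕃 (h𝕃.maxDeco t).ctx t.toCtx :=
  (exists_deco_isMaxTop h𝕃 t).choose_spec.1

theorem flat_maxDeco (t : Term S V) : (h𝕃.maxDeco t).flat = t :=
  (exists_deco_isMaxTop h𝕃 t).choose_spec.2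

theorem isAlien_iff_inr_mem_vars_maxDeco {u t : Term S V} :
    IsAlien 𝕃 u t ↔ Sum.inr u ∈ (h𝕃.maxDeco t).vars := by
  have hmax := isMaxTop_ctx_maxDeco h𝕃 t
  constructor
  · rintro ⟨M, p, hM, -, hp, hu⟩
    rw [hM.unique h𝕃 hmax] at hp
    rw [← flat_maxDeco h𝕃 t] at hu
    exact inr_mem_vars_of_ctx_subtermAt hp hu
  · intro hu
    obtain ⟨p, hp⟩ := exists_subtermAt_of_mem_vars hu
    refine ⟨_, p, hmax, hmax.ne_hole h𝕃, subtermAt_ctx hp, ?_⟩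
    exact flat_maxDeco h𝕃 t ▸ subtermAt_flat hp

theorem refine_maxDeco {D : Deco S V} (hD : D.ctx ∈ 𝕃) : Refine D (h𝕃.maxDeco D.flat) :=
  refine_of_ctx_le ((isMaxTop_ctx_maxDeco h𝕃 _).greatest h𝕃 ⟨hD, ctx_le D⟩)
    (flat_maxDeco h𝕃 _).symm

omit h𝕃 in
/-- The property of maximal decompositions that, unlike maximality itself, is inherited by
subterms. -/
def Deco.Full (𝕃 : Set (Ctx S V)) (E : Deco S V) : Prop :=
  ∀ p f Es, E.subtermAt p = some (app f Es) →
    ∀ N, IsTop 𝕃 N (flat (app f Es)).toCtx → Ctx.Le N (ctx (app f Es))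

omit h𝕃 in
theorem Deco.Full.arg {f : S.Sym} {Es : Fin (S.arity f) → Deco S V} (h : Full 𝕃 (app f Es))
    (i : Fin (S.arity f)) : Full 𝕃 (Es i) :=
  fun p g Fs hp => h (i :: p) g Fs ((subtermAt_app_cons f Es i p).trans hp)

theorem full_maxDeco (t : Term S V) : Full 𝕃 (h𝕃.maxDeco t) := by
  intro p f Es hp N hN
  have hmax := isMaxTop_ctx_maxDeco h𝕃 t
  have hpC := subtermAt_ctx hp
  have hpt : t.toCtx.subtermAt p = some (flat (app f Es)).toCtx :=
    subtermAt_lift 0 (flat_maxDeco h𝕃 t ▸ subtermAt_flat hp)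
  obtain ⟨E, hCE, hNE, hmin⟩ := Ctx.exists_merge (ctx_le (app f Es)) hN.2
  have htop : IsTop 𝕃 ((h𝕃.maxDeco t).ctx.replaceAt p E) t.toCtx :=
    ⟨h𝕃.merge_mem _ hmax.1.1 N hN.1 p ⟨f, _, hpC⟩ _ hpC E ⟨hCE, hNE, hmin⟩,
      Ctx.replaceAt_le hmax.1.2 hpC hpt (hmin _ (ctx_le _) hN.2)⟩
  exact hNE.trans (Ctx.le_subtermAt (hmax.greatest h𝕃 htop) (subtermAt_replaceAt E hpC) hpC)

omit h𝕃 in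
theorem Deco.Refine.exists_box {D E : Deco S V} (h : Refine D E) (hE : Full 𝕃 E) {u : Term S V}
    (hu : Sum.inr u ∈ E.vars) :
    ∃ F : Deco S V, Full 𝕃 F ∧ Sum.inr F.flat ∈ D.vars ∧ Sum.inr u ∈ F.vars := by
  induction h with
  | inl x => cases hu
  | inr E => exact ⟨E, hE, rfl, hu⟩
  | app f Ds Es _ ih =>
    obtain ⟨i, hi⟩ := mem_vars_app.1 hu
    obtain ⟨F, hF, hFD, huF⟩ := ih i (hE.arg i) hi
    exact ⟨F, hF, mem_vars_app.2 ⟨i, hFD⟩, huF⟩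

theorem Deco.Full.eq_or_rank_lt {E : Deco S V} (hE : Full 𝕃 E) {u : Term S V}
    (hu : Sum.inr u ∈ E.vars) : E = var (Sum.inr u) ∨ rank 𝕃 u < rank 𝕃 E.flat := by
  induction hk : rank 𝕃 E.flat using Nat.strong_induction_on generalizing E with
  | _ k ih =>
    subst hk
    match E with
    | var x =>
      obtain rfl : Sum.inr u = x := hu
      exact .inl rfl
    | app f Es =>
      have hrefine : Refine (h𝕃.maxDeco (flat (app f Es))) (app f Es) :=
        refine_of_ctx_le (hE [] f Es (subtermAt_nil _) _ (isMaxTop_ctx_maxDeco h𝕃 _).1)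
          (flat_maxDeco h𝕃 _)
      obtain ⟨F, hF, hFD, huF⟩ := hrefine.exists_box hE hu
      have hlt := ((isAlien_iff_inr_mem_vars_maxDeco h𝕃).2 hFD).rank_lt
      obtain rfl | h := ih _ hlt hF huF rfl
      · exact .inr hlt
      · exact .inr (h.trans hlt)

theorem rank_flat_le {D : Deco S V} (hD : D.ctx ∈ 𝕃) {k : ℕ}
    (hk : ∀ w, Sum.inr w ∈ D.vars → rank 𝕃 w ≤ k) : rank 𝕃 D.flat ≤ k + 1 := by
  refine rank_le_succ_iff.2 fun u hu => ?_
  obtain ⟨F, hF, hFD, huF⟩ := (refine_maxDeco h𝕃 hD).exists_box (full_maxDeco h𝕃 _)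
    ((isAlien_iff_inr_mem_vars_maxDeco h𝕃).1 hu)
  obtain rfl | hlt := hF.eq_or_rank_lt h𝕃 huF
  · exact hk _ hFD
  · exact hlt.le.trans (hk _ hFD)

theorem ctx_rename_mem {D : Deco S V} (hD : D.ctx ∈ 𝕃)
    (f : V ⊕ Term S V → V ⊕ Term S V) : ctx (D.bind fun x => var (f x)) ∈ 𝕃 := by
  have isAtom : ∀ x : V ⊕ Term S V, Ctx.IsAtom (Sum.elim var (fun _ => hole) x : Ctx S V) := by
    rintro (x | u)
    · exact .inr ⟨x, rfl⟩
    · exact .inl rfl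
  rw [ctx, lift_bind, bind_bind]
  exact bind_mem_of_isAtom h𝕃 isAtom (fun x => isAtom (f x)) hD

theorem rank_rename_le (f : V → V) (t : Term S V) :
    rank 𝕃 (t.bind fun x => var (f x)) ≤ rank 𝕃 t := by
  suffices ∀ k t, rank 𝕃 t ≤ k → rank 𝕃 (t.bind fun x => var (f x)) ≤ k from this _ t le_rfl
  intro k
  induction k with
  | zero => exact fun t ht => absurd ht (Nat.not_le_of_gt (one_le_rank 𝕃 t))
  | succ k ih =>
    intro t ht
    have hflat : flat ((h𝕃.maxDeco t).bind fun x =>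
        var (Sum.map f (fun u => u.bind fun x => var (f x)) x)) =
          t.bind fun x => var (f x) := by
      conv_rhs => rw [← flat_maxDeco h𝕃 t]
      rw [flat, flat, bind_bind, bind_bind]
      exact bind_congr fun x _ => by cases x <;> rfl
    rw [← hflat]
    refine rank_flat_le h𝕃 (ctx_rename_mem h𝕃 (isMaxTop_ctx_maxDeco h𝕃 t).1.1 _) fun w hw => ?_
    obtain ⟨x | u, hx, hxw⟩ := mem_vars_bind.1 hw
    · cases hxw
    · cases hxw
      exact ih u (rank_le_succ_iff.1 ht u ((isAlien_iff_inr_mem_vars_maxDeco h𝕃).2 hx))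

end MaxDeco

/-! ### Rewriting decompositions -/

namespace Deco

open Term

variable {R : TRS S V} {b : Term S V → Term S V → Prop} {D D' : Deco S V}

/-- A `b`-step on the content of a box. -/
inductive BoxStep (b : Term S V → Term S V → Prop) : Deco S V → Deco S V → Prop
  | of {u v : Term S V} : b u v → BoxStep b (var (Sum.inr u)) (var (Sum.inr v))

/-- A step of a decomposition: by `R` outside the boxes, or by `b` in the content of a box. -/
def Step (R : TRS S V) (b : Term S V → Term S V → Prop) : Deco S V → Deco S V → Prop :=
  ContextClosure (R.RootStep ⊔ BoxStep b)

theorem contextClosed_step (R : TRS S V) (b : Term S V → Term S V → Prop) :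
    ContextClosed (Step R b) :=
  contextClosed_contextClosure _

theorem step_le {T : Deco S V → Deco S V → Prop} (hT : ContextClosed T)
    (root : ∀ D D', R.RootStep D D' → T D D')
    (box : ∀ u v, b u v → T (var (Sum.inr u)) (var (Sum.inr v))) : Step R b ≤ T :=
  hT.contextClosure_le (sup_le root fun _ _ h => by cases h with | of h => exact box _ _ h)

theorem Step.of_rewrite (h : R.Rewrite D D') : Step R b D D' :=
  ContextClosure.mono le_sup_left _ _ h

theorem Step.of_box {u v : Term S V} (h : b u v) :
    Step R b (var (Sum.inr u)) (var (Sum.inr v)) :=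
  .of (.inr (.of h))

theorem Step.mono {b' : Term S V → Term S V → Prop} (hb : b ≤ b') (h : Step R b D D') :
    Step R b' D D' :=
  step_le (contextClosed_step R b') (fun _ _ h => .of (.inl h)) (fun u v h => .of_box (hb u v h))
    _ _ h

theorem Step.exists_box (h : Step R b D D') {v : Term S V} (hv : Sum.inr v ∈ D'.vars) :
    ∃ u, Sum.inr u ∈ D.vars ∧ ReflGen b u v := by
  let q : V ⊕ Term S V → V ⊕ Term S V → Prop := Sum.LiftRel Eq (ReflGen b)
  have hq : ∀ x, q x x := by
    rintro (x | u)
    · exact .inl rfl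
    · exact .inr .refl
  obtain ⟨_, hu, hq⟩ := step_le (R := R) (b := b) (contextClosed_vars hq)
    (fun _ _ h y hy => ⟨y, h.vars_subset hy, hq y⟩)
    (fun u v h y hy => ⟨_, rfl, hy ▸ .inr (.single h)⟩) _ _ h _ hv
  cases hq with
  | inr hq => exact ⟨_, hu, hq⟩

theorem Step.flat (h : Step R b D D') (hb : b ≤ R.Rewrite) : R.Rewrite D.flat D'.flat :=
  step_le ((contextClosed_rewrite R).comap_bind _) (fun _ _ h => .of (h.bind _)) hb _ _ h

theorem exists_eq_bind {l : Term S V} {τ : V → Ctx S V} {σ : V → Term S V}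
    (hctx : D.ctx = (l.lift 0).bind τ) (hflat : D.flat = l.bind σ) :
    ∃ υ : V → Deco S V, D = l.bind υ ∧ ∀ x ∈ l.vars, (υ x).ctx = τ x ∧ (υ x).flat = σ x := by
  have hle : Ctx.Le ((l.lift 0).bind τ) ((l.lift 0).bind fun x => (σ x).toCtx) := by
    rw [← hctx]
    exact lift_bind 0 σ l ▸ hflat ▸ ctx_le D
  have exists_arg : ∀ x, ∃ E : Deco S V, x ∈ l.vars → E.ctx = τ x ∧ E.flat = σ x := by
    intro x
    by_cases hx : x ∈ l.vars
    · exact (exists_of_le (Ctx.le_of_bind_le hle hx)).imp fun _ hE _ => hE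
    · exact ⟨embed (σ x), fun h => absurd h hx⟩
  choose υ hυ using exists_arg
  refine ⟨υ, ext_ctx_flat ?_ ?_, hυ⟩
  · exact hctx.trans (ctx_bind fun x hx => (hυ x hx).1).symm
  · exact hflat.trans (flat_bind fun x hx => (hυ x hx).2).symm

theorem exists_step_of_subtermAt_eq_box (R : TRS S V) {p : List ℕ} {u v : Term S V}
    (hp : D.subtermAt p = some (var (Sum.inr u))) (huv : b u v) :
    ∃ D' : Deco S V, D'.ctx = D.ctx ∧ D'.flat = D.flat.replaceAt p v ∧ Step R b D D' :=
  ⟨D.replaceAt p (var (Sum.inr v)),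
    (ctx_replaceAt _ hp).trans (replaceAt_self (u := hole) (subtermAt_ctx hp)),
    flat_replaceAt _ hp,
    contextClosure_iff_subtermAt.2 ⟨p, _, _, hp, .inr (.of huv), rfl⟩⟩

end Deco

section WeaklyLayered

open Term Deco

variable {R : TRS S V} {𝕃 : Set (Ctx S V)} {s t : Term S V}

theorem exists_step_maxDeco (h𝕃 : IsLayerSystem 𝕃) (hW : WeaklyLayered R 𝕃)
    (h : R.Rewrite s t) : ∃ D : Deco S V, D.ctx ∈ 𝕃 ∧ D.flat = t ∧
      Deco.Step R (fun u v => IsAlien 𝕃 u s ∧ R.Rewrite u v) (h𝕃.maxDeco s) D := by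
  have hmax := isMaxTop_ctx_maxDeco h𝕃 s
  have hflat := flat_maxDeco h𝕃 s
  obtain ⟨p, _, _, hs, ⟨ρ, hρ, σ, rfl, rfl⟩, rfl⟩ := contextClosure_iff_subtermAt.1 h
  obtain ⟨f, Ds, hp⟩ | ⟨q, q', x, rfl, hq, hq'⟩ := subtermAt_bind_cases (hflat.symm ▸ hs)
  · obtain ⟨L, hL, τ, hτ, rfl⟩ := hW ρ hρ s _ _ p hmax ⟨f, _, subtermAt_ctx hp⟩
      ⟨σ, by rwa [subst_eq_bind], rfl⟩
    rw [subtermAt_ctx hp, Option.some_inj, subst_eq_bind] at hτ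
    have hσ : flat (app f Ds) = ρ.lhs.bind σ :=
      Option.some_inj.1 ((subtermAt_flat hp).symm.trans (hflat.symm ▸ hs))
    obtain ⟨υ, hυ, hargs⟩ := exists_eq_bind hτ hσ
    refine ⟨(h𝕃.maxDeco s).replaceAt p (ρ.rhs.bind υ), ?_, ?_, .of_rewrite
      (contextClosure_iff_subtermAt.2 ⟨p, _, _, hp, ⟨ρ, hρ, υ, hυ, rfl⟩, rfl⟩)⟩
    · rw [ctx_replaceAt _ hp, ctx_bind fun x hx => (hargs x (ρ.vars_subset hx)).1]
      rw [subst_eq_bind] at hL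
      exact hL
    · rw [flat_replaceAt _ hp, hflat, flat_bind fun x hx => (hargs x (ρ.vars_subset hx)).2]
  · obtain x | u := x
    · match hl : ρ.lhs with
      | var y => exact absurd hl (ρ.lhs_ne_var y)
      | app f ls =>
        rw [hl] at hq'
        cases q' <;> cases hq'
    · have hu : IsAlien 𝕃 u s := (isAlien_iff_inr_mem_vars_maxDeco h𝕃).2
        (vars_subset_of_subtermAt hq rfl)
      have huv : R.Rewrite u (u.replaceAt q' (ρ.rhs.bind σ)) :=
        contextClosure_iff_subtermAt.2 ⟨q', _, _, hq', ⟨ρ, hρ, σ, rfl, rfl⟩, rfl⟩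
      obtain ⟨D, hctx, hD, step⟩ := exists_step_of_subtermAt_eq_box R
        (b := fun u v => IsAlien 𝕃 u s ∧ R.Rewrite u v) hq ⟨hu, huv⟩
      refine ⟨D, hctx ▸ hmax.1.1, ?_, step⟩
      rw [hD, hflat, replaceAt_append]
      exact hflat ▸ subtermAt_flat hq

theorem TRS.Rewrite.rank_le (h𝕃 : IsLayerSystem 𝕃) (hW : WeaklyLayered R 𝕃)
    (h : R.Rewrite s t) : rank 𝕃 t ≤ rank 𝕃 s := by
  induction hn : s.size using Nat.strong_induction_on generalizing s t with
  | _ n ih =>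
    subst hn
    obtain ⟨D, hD, rfl, step⟩ := exists_step_maxDeco h𝕃 hW h
    obtain ⟨k, hk⟩ := Nat.exists_eq_add_of_le' (one_le_rank 𝕃 s)
    rw [hk]
    refine rank_flat_le h𝕃 hD fun v hv => ?_
    obtain ⟨u, hu, huv⟩ := step.exists_box hv
    have alien := (isAlien_iff_inr_mem_vars_maxDeco h𝕃).2 hu
    have hu : rank 𝕃 u ≤ k := rank_le_succ_iff.1 hk.le u alien
    obtain _ | huv := huv
    · exact hu
    · exact (ih _ alien.size_lt huv.2 rfl).trans hu

theorem rank_le_of_reflTransGen (h𝕃 : IsLayerSystem 𝕃) (hW : WeaklyLayered R 𝕃)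
    (h : ReflTransGen R.Rewrite s t) : rank 𝕃 t ≤ rank 𝕃 s := by
  induction h with
  | refl => exact le_rfl
  | tail _ h ih => exact (h.rank_le h𝕃 hW).trans ih

end WeaklyLayered

theorem TRS.Rewrite.diamond {R : TRS (S.adjoin 1) V} {s t : Term (S.adjoin 1) V}
    (h : R.Rewrite s t) : R.Rewrite (diamond s) (diamond t) := by
  have eq_update (w : Term (S.adjoin 1) V) :
      (fun _ : Fin 1 => w) = Function.update (fun _ => s) 0 w :=
    funext fun i => by rw [Subsingleton.elim i 0, Function.update_self]
  have step := contextClosed_rewrite R none (fun _ => s) (0 : Fin 1) s t h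
  exact (congrArg₂ R.Rewrite (congrArg (Term.app (S := S.adjoin 1) none) (eq_update s))
    (congrArg (Term.app (S := S.adjoin 1) none) (eq_update t))).mpr step

/-! ### Opening and marking boxes -/

namespace Deco

open Term

variable {R : TRS S V} {𝕃 : Set (Ctx S V)} {b : Term S V → Term S V → Prop} {r : ℕ}
  {D E : Deco S V}

/-- The opening of one box that is the whole decomposition. -/
inductive OpenBox : Deco S V → Deco S V → Prop
  | of (u : Term S V) : OpenBox (var (Sum.inr u)) (embed u)

/-- The opening of one box. -/
def Unbox : Deco S V → Deco S V → Prop :=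
  ContextClosure OpenBox

theorem contextClosed_unbox : ContextClosed (Unbox (S := S) (V := V)) :=
  contextClosed_contextClosure _

theorem Unbox.flat_eq (h : Unbox D E) : D.flat = E.flat := by
  have closed : ContextClosed fun D E : Deco S V => D.flat = E.flat :=
    ContextClosed.comap_bind (T := Eq) (fun _ _ _ _ _ h => h ▸ rfl) _
  refine closed.contextClosure_le ?_ _ _ h
  rintro _ _ ⟨u⟩
  exact (flat_embed u).symm

theorem flat_eq_of_reflTransGen_unbox (h : ReflTransGen Unbox D E) : D.flat = E.flat := by
  induction h with
  | refl => rfl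
  | tail _ h ih => exact ih.trans h.flat_eq

/-- The decomposition obtained by opening all boxes whose content does not have rank `r`. -/
noncomputable def shorten (𝕃 : Set (Ctx S V)) (r : ℕ) (D : Deco S V) : Deco S V :=
  D.bind (Sum.elim (fun x => var (Sum.inl x))
    fun u => if rank 𝕃 u = r then var (Sum.inr u) else embed u)

theorem contextClosed_shorten {T : Deco S V → Deco S V → Prop} (hT : ContextClosed T) :
    ContextClosed fun D E : Deco S V => T (D.shorten 𝕃 r) (E.shorten 𝕃 r) :=
  hT.comap_bind _

theorem shorten_box_of_rank_eq {u : Term S V} (hu : rank 𝕃 u = r) :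
    shorten 𝕃 r (var (Sum.inr u)) = var (Sum.inr u) :=
  if_pos hu

theorem shorten_box_of_rank_ne {u : Term S V} (hu : rank 𝕃 u ≠ r) :
    shorten 𝕃 r (var (Sum.inr u)) = embed u :=
  if_neg hu

theorem reflTransGen_unbox_shorten_box (u : Term S V) :
    ReflTransGen Unbox (var (Sum.inr u)) (shorten 𝕃 r (var (Sum.inr u))) := by
  by_cases hu : rank 𝕃 u = r
  · rw [shorten_box_of_rank_eq hu]
  · rw [shorten_box_of_rank_ne hu]
    exact .single (.of (.of u))

theorem reflTransGen_shorten_box_embed (u : Term S V) :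
    ReflTransGen Unbox (shorten 𝕃 r (var (Sum.inr u))) (embed u) := by
  by_cases hu : rank 𝕃 u = r
  · rw [shorten_box_of_rank_eq hu]
    exact .single (.of (.of u))
  · rw [shorten_box_of_rank_ne hu]

theorem flat_shorten (r : ℕ) (D : Deco S V) : (D.shorten 𝕃 r).flat = D.flat := by
  refine (bind_bind ..).trans (bind_congr fun x _ => ?_)
  obtain x | u := x
  · rfl
  · change flat (if _ then _ else _) = u
    split_ifs
    · rfl
    · exact flat_embed u

theorem shorten_eq_embed (h : ∀ u, Sum.inr u ∈ D.vars → rank 𝕃 u ≠ r) :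
    D.shorten 𝕃 r = embed D.flat := by
  refine Eq.trans (bind_congr fun x hx => ?_) (bind_bind ..).symm
  obtain x | u := x
  · rfl
  · exact shorten_box_of_rank_ne (h u hx)

theorem Refine.reflTransGen_unbox_shorten (h𝕃 : IsLayerSystem 𝕃) (h : Refine D E)
    (hE : Full 𝕃 E) (hr : ∀ u, Sum.inr u ∈ D.vars → rank 𝕃 u ≤ r) :
    ReflTransGen Unbox (D.shorten 𝕃 r) (E.shorten 𝕃 r) := by
  induction h with
  | inl x => exact .refl
  | inr E =>
    by_cases hbox : ∃ u, E = var (Sum.inr u)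
    · obtain ⟨u, rfl⟩ := hbox
      exact .refl
    · have hE : E.shorten 𝕃 r = embed E.flat := by
        refine shorten_eq_embed fun u hu => ?_
        obtain h | h := hE.eq_or_rank_lt h𝕃 hu
        · exact absurd ⟨u, h⟩ hbox
        · exact (h.trans_le (hr _ rfl)).ne
      exact hE ▸ reflTransGen_shorten_box_embed E.flat
  | app f Ds Es _ ih =>
    exact contextClosed_unbox.reflTransGen_app f fun i =>
      ih i (hE.arg i) fun u hu => hr u (mem_vars_app.2 ⟨i, hu⟩)

/-- The term in which each box is marked by the symbol `◊`, so that opening a box is a rewrite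
step by the rule `◊(x) → x`. -/
def mark (D : Deco S V) : Term (S.adjoin 1) V :=
  (D.lift 1).bind (Sum.elim var fun u => diamond (u.lift 1))

theorem mark_embed (u : Term S V) : mark (embed u) = u.lift 1 := by
  rw [mark, embed, lift_bind, bind_bind]
  exact bind_var _

theorem contextClosed_mark (R' : TRS (S.adjoin 1) V) :
    ContextClosed fun D E : Deco S V => R'.Rewrite D.mark E.mark :=
  ((contextClosed_rewrite R').comap_bind _).comap_lift

theorem Unbox.mark [Nonempty V] (h : Unbox D E) :
    (diamondTRS (V := V)).Rewrite D.mark E.mark := by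
  refine (contextClosed_mark diamondTRS).contextClosure_le ?_ _ _ h
  rintro _ _ ⟨u⟩
  exact .of ⟨_, ⟨Classical.arbitrary V, rfl⟩, fun _ => u.lift 1, rfl, mark_embed u⟩

theorem Step.mark (h : Step R b D E) (hb : b ≤ R.Rewrite) :
    (R.lift 1).Rewrite D.mark E.mark :=
  step_le (contextClosed_mark (R.lift 1)) (fun _ _ h => .of ((h.lift 1).bind _))
    (fun u v h => ((hb u v h).lift 1).diamond) _ _ h

/-- The term over the set `Q` of names of boxes, for a naming `q` of the contents of boxes. -/
def nameBoxes {Q : Type*} (q : Term S V → Q) (D : Deco S V) : Term S (V ⊕ Q) :=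
  D.bind fun x => var (Sum.map id q x)

theorem Step.nameBoxes {Q : Type*} {q : Term S V → Q} (hq : ∀ u v, b u v → q u = q v)
    (h : Step R b D E) : ReflTransGen R.Rewrite (D.nameBoxes q) (E.nameBoxes q) := by
  refine step_le ((contextClosed_rewrite R).reflTransGen.comap_bind _)
    (fun _ _ h => .single (.of (h.bind _))) (fun u v huv => ?_) _ _ h
  change ReflTransGen _ (var (Sum.inr (q u))) (var (Sum.inr (q v)))
  rw [hq u v huv]

end Deco

/-! ### Simulation of a reduction on short decompositions -/

section Simulation

open Term Deco

variable {R : TRS S V} {𝕃 : Set (Ctx S V)} {r : ℕ} {s t : Term S V} {D D' : Deco S V}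

/-- The rewrite relation on the terms of rank at most `r`. -/
def LowStep (R : TRS S V) (𝕃 : Set (Ctx S V)) (r : ℕ) (s t : Term S V) : Prop :=
  R.Rewrite s t ∧ rank 𝕃 s ≤ r ∧ rank 𝕃 t ≤ r

theorem lowStep_le : LowStep R 𝕃 r ≤ R.Rewrite := fun _ _ h => h.1

/-- The decomposition of `t` into its aliens of rank `r` and the rest of `t`. It is applied to
terms of rank at most `r + 1`. -/
noncomputable def IsLayerSystem.shortDeco (h𝕃 : IsLayerSystem 𝕃) (r : ℕ) (t : Term S V) :
    Deco S V :=
  (h𝕃.maxDeco t).shorten 𝕃 r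

theorem flat_shortDeco (h𝕃 : IsLayerSystem 𝕃) (r : ℕ) (t : Term S V) :
    (h𝕃.shortDeco r t).flat = t :=
  (flat_shorten r _).trans (flat_maxDeco h𝕃 t)

theorem exists_reflTransGen_step_shorten (h𝕃 : IsLayerSystem 𝕃) (hW : WeaklyLayered R 𝕃)
    (h : Deco.Step R (LowStep R 𝕃 r) D D') :
    ∃ A, ReflTransGen (Deco.Step R (LowStep R 𝕃 r)) (D.shorten 𝕃 r) A ∧
      ReflTransGen Unbox A (D'.shorten 𝕃 r) := by
  have step_closed := (contextClosed_step R (LowStep R 𝕃 r)).reflTransGen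
  have unbox_closed := (contextClosed_unbox (S := S) (V := V)).reflTransGen
  refine step_le (contextClosed_shorten (step_closed.comp unbox_closed))
    (fun _ D' h => ⟨shorten 𝕃 r D', .single (.of (.inl (h.bind _))), .refl⟩)
    (fun u v h => ?_) _ _ h
  obtain hu | hu := h.2.1.eq_or_lt
  · refine ⟨var (Sum.inr v), ?_, reflTransGen_unbox_shorten_box v⟩
    rw [shorten_box_of_rank_eq hu]
    exact .single (.of_box h)
  · refine ⟨embed v, ?_, ?_⟩
    · exact shorten_box_of_rank_ne hu.ne ▸ .single (.of_rewrite (h.1.bind _))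
    · exact shorten_box_of_rank_ne ((h.1.rank_le h𝕃 hW).trans_lt hu).ne ▸ .refl

theorem exists_reflTransGen_step_shortDeco (h𝕃 : IsLayerSystem 𝕃) (hW : WeaklyLayered R 𝕃)
    (h : R.Rewrite s t) (hs : rank 𝕃 s ≤ r + 1) :
    ∃ A, ReflTransGen (Deco.Step R (LowStep R 𝕃 r)) (h𝕃.shortDeco r s) A ∧
      ReflTransGen Unbox A (h𝕃.shortDeco r t) := by
  obtain ⟨D, hD, rfl, step⟩ := exists_step_maxDeco h𝕃 hW h
  have low_step : Deco.Step R (LowStep R 𝕃 r) (h𝕃.maxDeco s) D :=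
    by
    refine step.mono fun u v h => ?_
    have hu := rank_le_succ_iff.1 hs u h.1
    exact ⟨h.2, hu, (h.2.rank_le h𝕃 hW).trans hu⟩
  obtain ⟨A, hsA, hAD⟩ := exists_reflTransGen_step_shorten h𝕃 hW low_step
  refine ⟨A, hsA, hAD.trans ((refine_maxDeco h𝕃 hD).reflTransGen_unbox_shorten h𝕃
    (full_maxDeco h𝕃 _) fun v hv => ?_)⟩
  obtain ⟨u, hu, huv⟩ := low_step.exists_box hv
  obtain _ | huv := huv
  · exact rank_le_succ_iff.1 hs v ((isAlien_iff_inr_mem_vars_maxDeco h𝕃).2 hu)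
  · exact huv.2.2

theorem transGen_relStep_mark [Nonempty V] {A : Deco S V}
    (hDA : ReflTransGen (Deco.Step R (LowStep R 𝕃 r)) D A) (hAD' : TransGen Unbox A D') :
    TransGen (RelStep diamondTRS (R.lift 1)) D.mark D'.mark := by
  have hDA : ReflTransGen (R.lift 1).Step D.mark A.mark := by
    rw [step_eq_rewrite]
    exact hDA.lift mark fun _ _ h => h.mark lowStep_le
  have relStep {E F : Deco S V} (h : Unbox E F) : (diamondTRS (V := V)).Step E.mark F.mark := by
    rw [step_eq_rewrite]
    exact h.mark
  obtain ⟨E, hAE, hED'⟩ := TransGen.head'_iff.1 hAD'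
  refine TransGen.head' ⟨A.mark, hDA, E.mark, relStep hAE, .refl⟩ ?_
  exact hED'.lift mark fun _ _ h => ⟨_, .refl, _, relStep h, .refl⟩

theorem exists_simulation [Nonempty V] (h𝕃 : IsLayerSystem 𝕃) (hW : WeaklyLayered R 𝕃)
    (hs : rank 𝕃 s ≤ r + 1) (h : ReflTransGen R.Rewrite s t) :
    ∃ A, ReflTransGen (Deco.Step R (LowStep R 𝕃 r)) (h𝕃.shortDeco r s) A ∧
      ReflTransGen R.Rewrite A.flat t ∧
      (A = h𝕃.shortDeco r t ∨ TransGen (RelStep diamondTRS (R.lift 1))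
        (h𝕃.shortDeco r s).mark (h𝕃.shortDeco r A.flat).mark) := by
  induction h with
  | refl => exact ⟨_, .refl, (flat_shortDeco h𝕃 r s).symm ▸ .refl, .inl rfl⟩
  | tail hst htt' ih =>
    rename_i t t'
    obtain ⟨A, hsA, hAt, rfl | decrease⟩ := ih
    · obtain ⟨A', hA', hunbox⟩ := exists_reflTransGen_step_shortDeco h𝕃 hW htt'
        ((rank_le_of_reflTransGen h𝕃 hW hst).trans hs)
      have flat_eq : A'.flat = t' :=
        (Deco.flat_eq_of_reflTransGen_unbox hunbox).trans (flat_shortDeco h𝕃 r t')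
      refine ⟨A', hsA.trans hA', flat_eq ▸ .refl, ?_⟩
      rw [flat_eq]
      exact (Relation.reflTransGen_iff_eq_or_transGen.1 hunbox).imp Eq.symm
        (transGen_relStep_mark (hsA.trans hA'))
    · exact ⟨A, hsA, hAt.tail htt', .inr decrease⟩

end Simulation

/-! ### Confluence -/

namespace Deco

open Term

variable {R : TRS S V} {b : Term S V → Term S V → Prop} {D A₁ A₂ : Deco S V}

theorem reflTransGen_flat_nameBoxes_bind {Q : Type*} {q : Term S V → Q} {g : Q → Term S V}
    (h : ∀ u, Sum.inr u ∈ D.vars → ReflTransGen R.Rewrite u (g (q u))) :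
    ReflTransGen R.Rewrite D.flat ((D.nameBoxes q).bind (Sum.elim var g)) := by
  rw [nameBoxes, bind_bind]
  refine (contextClosed_rewrite R).reflTransGen_bind fun x hx => ?_
  obtain x | u := x
  · exact .refl
  · exact h u hx

theorem join_flat (hb : b ≤ R.Rewrite) (hconf : Confluent b)
    (hD : ConfluentAt R.Rewrite (D.nameBoxes (Quotient.mk hconf.joinSetoid)))
    (h₁ : ReflTransGen (Step R b) D A₁) (h₂ : ReflTransGen (Step R b) D A₂) :
    Join (ReflTransGen R.Rewrite) A₁.flat A₂.flat := by
  let q : Term S V → Quotient hconf.joinSetoid := Quotient.mk _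
  have hq (u v : Term S V) (h : b u v) : q u = q v := Quotient.sound ⟨v, .single h, .refl⟩
  have name_reduction {A : Deco S V} (h : ReflTransGen (Step R b) D A) :
      ReflTransGen R.Rewrite (D.nameBoxes q) (A.nameBoxes q) :=
    ReflTransGen.lift' (nameBoxes q) (fun _ _ h => h.nameBoxes hq) _ _ h
  obtain ⟨N, h₁N, h₂N⟩ := hD _ _ (name_reduction h₁) (name_reduction h₂)
  obtain ⟨g, hg⟩ := hconf.exists_common_reducts (F := Sum.inr ⁻¹' (A₁.vars ∪ A₂.vars))
    ((A₁.finite_vars.union A₂.finite_vars).preimage Sum.inr_injective.injOn)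
  have flat_reduction {A : Deco S V} (hA : A.vars ⊆ A₁.vars ∪ A₂.vars)
      (h : ReflTransGen R.Rewrite (A.nameBoxes q) N) :
      ReflTransGen R.Rewrite A.flat (N.bind (Sum.elim var g)) :=
    (reflTransGen_flat_nameBoxes_bind fun u hu => ReflTransGen.mono hb _ _ (hg u (hA hu))).trans
      (reflTransGen_rewrite_bind h _)
  exact ⟨_, flat_reduction Set.subset_union_left h₁N, flat_reduction Set.subset_union_right h₂N⟩

end Deco

section WeaklyLayered

open Term Deco

variable {R : TRS S V} {𝕃 : Set (Ctx S V)} {s : Term S V} {k : ℕ}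

theorem rank_rename_shortDeco_le (h𝕃 : IsLayerSystem 𝕃) (hs : rank 𝕃 s ≤ k + 2)
    (f : V ⊕ Term S V → V) :
    rank 𝕃 ((h𝕃.shortDeco (k + 1) s).bind fun x => var (f x)) ≤ k + 1 := by
  let f' : V ⊕ Term S V → V ⊕ Term S V := Sum.elim (fun x => Sum.inl (f (Sum.inl x)))
    fun u => if rank 𝕃 u = k + 1 then Sum.inl (f (Sum.inr u))
      else Sum.inr (u.bind fun x => var (f (Sum.inl x)))
  have flat_eq : Deco.flat ((h𝕃.maxDeco s).bind fun x => var (f' x)) =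
      (h𝕃.shortDeco (k + 1) s).bind fun x => var (f x) := by
    refine (bind_bind ..).trans (Eq.trans (bind_congr fun x _ => ?_) (bind_bind ..).symm)
    obtain x | u := x
    · rfl
    · by_cases hu : rank 𝕃 u = k + 1
      · simp [f', hu, Term.bind]
      · simp [f', hu, Term.bind, bind_bind, embed]
  rw [← flat_eq]
  refine rank_flat_le h𝕃 (ctx_rename_mem h𝕃 (isMaxTop_ctx_maxDeco h𝕃 s).1.1 f') fun w hw => ?_
  obtain ⟨x | u, hx, hw⟩ := mem_vars_bind.1 hw
  · cases hw
  · replace hw : Sum.inr w = f' (Sum.inr u) := hw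
    have hu := rank_le_succ_iff.1 hs u ((isAlien_iff_inr_mem_vars_maxDeco h𝕃).2 hx)
    obtain hu | hu := hu.eq_or_lt
    · simp [f', hu] at hw
    · simp only [f', Sum.elim_inr, if_neg hu.ne, Sum.inr.injEq] at hw
      exact hw ▸ (rank_rename_le h𝕃 _ u).trans (Nat.le_of_lt_succ hu)

theorem confluentOn_rank_le_succ [Infinite V] (h𝕃 : IsLayerSystem 𝕃) (hW : WeaklyLayered R 𝕃)
    (hB : BoundedDuplicating R) (hk : ConfluentOn R.Rewrite {t | rank 𝕃 t ≤ k + 1}) :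
    ConfluentOn R.Rewrite {t | rank 𝕃 t ≤ k + 2} := by
  have closed (l : ℕ) : ∀ s t, s ∈ {t | rank 𝕃 t ≤ l} → R.Rewrite s t → t ∈ {t | rank 𝕃 t ≤ l} :=
    fun _ _ hs h => (h.rank_le h𝕃 hW).trans hs
  rw [confluentOn_iff_forall_confluentAt (closed _)] at hk ⊢
  intro s
  induction s using (InvImage.wf (fun s => (h𝕃.shortDeco (k + 1) s).mark) hB).induction with
  | _ s ih =>
  intro hs t₁ t₂ h₁ h₂
  have exists_common_tail : ∀ {t}, ReflTransGen R.Rewrite s t → ∃ A,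
      ReflTransGen (Deco.Step R (LowStep R 𝕃 (k + 1))) (h𝕃.shortDeco (k + 1) s) A ∧
      ∀ w, ReflTransGen R.Rewrite A.flat w → Join (ReflTransGen R.Rewrite) t w := by
    intro t ht
    obtain ⟨A, hsA, hAt, rfl | decrease⟩ := exists_simulation h𝕃 hW hs ht
    · exact ⟨_, hsA, fun w hw => ⟨w, flat_shortDeco h𝕃 (k + 1) t ▸ hw, .refl⟩⟩
    · have hsA' : ReflTransGen R.Rewrite s A.flat := by
        simpa only [Function.onFun, flat_shortDeco] using
          ReflTransGen.lift flat (fun _ _ h => h.flat lowStep_le) _ _ hsA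
      have hA := ih A.flat decrease ((rank_le_of_reflTransGen h𝕃 hW hsA').trans hs)
      exact ⟨A, hsA, fun w hw => hA t w hAt hw⟩
  obtain ⟨A₁, hA₁, join₁⟩ := exists_common_tail h₁
  obtain ⟨A₂, hA₂, join₂⟩ := exists_common_tail h₂
  have hlow : Confluent (LowStep R 𝕃 (k + 1)) :=
    ((confluentOn_iff_forall_confluentAt (closed _)).2 hk).2
  have hshort : ConfluentAt R.Rewrite
      ((h𝕃.shortDeco (k + 1) s).nameBoxes (Quotient.mk hlow.joinSetoid)) :=
    confluentAt_of_rename fun f => by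
      rw [nameBoxes, bind_bind]
      exact hk _ (rank_rename_shortDeco_le h𝕃 hs fun x => f (Sum.map id (Quotient.mk _) x))
  obtain ⟨c, h₁c, h₂c⟩ := join_flat lowStep_le hlow hshort hA₁ hA₂
  obtain ⟨w, h₁w, hcw⟩ := join₁ c h₁c
  obtain ⟨z, h₂z, hwz⟩ := join₂ w (h₂c.trans hcw)
  exact ⟨z, h₁w.trans hwz, h₂z⟩

theorem confluent_of_boundedDuplicating [Infinite V] (h𝕃 : IsLayerSystem 𝕃)
    (hW : WeaklyLayered R 𝕃) (hone : ConfluentOn R.Step {t | rank 𝕃 t = 1})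
    (hB : BoundedDuplicating R) : Confluent R.Step := by
  rw [step_eq_rewrite] at hone ⊢
  have confluentOn_rank_le (k : ℕ) : ConfluentOn R.Rewrite {t | rank 𝕃 t ≤ k + 1} := by
    induction k with
    | zero => simpa only [(one_le_rank 𝕃 _).ge_iff_eq', zero_add] using hone
    | succ k ih => exact confluentOn_rank_le_succ h𝕃 hW hB ih
  intro s
  exact (confluentOn_iff_forall_confluentAt fun _ _ hs h => (h.rank_le h𝕃 hW).trans hs).1
    (confluentOn_rank_le (rank 𝕃 s)) s (Nat.le_succ _)

end WeaklyLayered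

/-! ### Non-duplicating systems -/

namespace Term

variable {W : Type*} {k : ℕ}

/-- The number of occurrences of the fresh symbol in a term. -/
def countFresh : Term (S.adjoin k) V → ℕ
  | var _ => 0
  | app f ts => (Option.elim f 1 fun _ => 0) + ∑ i, (ts i).countFresh

theorem countFresh_lift_bind (σ : W → Term (S.adjoin k) V) (t : Term S W) {F : Finset W}
    (hF : t.vars ⊆ F) :
    ((t.lift k).bind σ).countFresh = ∑ x ∈ F, t.countVar x * (σ x).countFresh := by
  induction t with
  | var y =>
    rw [Finset.sum_eq_single_of_mem y (hF rfl) fun x _ hxy => by simp [countVar, hxy.symm]]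
    simp [lift, bind, countVar]
  | app f ts ih =>
    calc (((app f ts).lift k).bind σ).countFresh
        = 0 + ∑ i : Fin (S.arity f), (((ts i).lift k).bind σ).countFresh := rfl
      _ = ∑ i, ∑ x ∈ F, (ts i).countVar x * (σ x).countFresh := by
        rw [zero_add]
        exact Finset.sum_congr rfl fun i _ => ih i ((Set.subset_iUnion _ i).trans hF)
      _ = ∑ x ∈ F, (app f ts).countVar x * (σ x).countFresh := by
        simp only [Finset.sum_comm (s := Finset.univ), countVar, Finset.sum_mul]

theorem exists_countFresh_app_update (f : (S.adjoin k).Sym)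
    (ts : Fin ((S.adjoin k).arity f) → Term (S.adjoin k) V) (i : Fin ((S.adjoin k).arity f)) :
    ∃ c, ∀ t, (app f (Function.update ts i t)).countFresh = c + t.countFresh := by
  refine ⟨(Option.elim f 1 fun _ => 0) + ∑ j ∈ Finset.univ.erase i, (ts j).countFresh,
    fun t => ?_⟩
  rw [countFresh, ← Finset.sum_erase_add _ _ (Finset.mem_univ i), Function.update_self, add_assoc,
    Finset.sum_congr rfl fun j hj => by rw [Function.update_of_ne (Finset.ne_of_mem_erase hj)]]

end Term

section NonDuplicating

open Term

variable {R : TRS S V} {k : ℕ}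

theorem countFresh_le_of_rewrite_lift (hR : NonDuplicating R) {s t : Term (S.adjoin k) V}
    (h : (R.lift k).Rewrite s t) : t.countFresh ≤ s.countFresh := by
  have closed : ContextClosed fun s t : Term (S.adjoin k) V => t.countFresh ≤ s.countFresh := by
    intro f ts i s t h
    obtain ⟨c, hc⟩ := exists_countFresh_app_update f ts i
    simpa only [hc, add_le_add_iff_left] using h
  refine closed.contextClosure_le ?_ _ _ h
  rintro _ _ ⟨_, ⟨ρ, hρ, rfl⟩, σ, rfl, rfl⟩
  have hF : ρ.lhs.vars ⊆ ρ.lhs.finite_vars.toFinset := ρ.lhs.finite_vars.coe_toFinset.ge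
  simp only [Rule.lift]
  rw [countFresh_lift_bind σ _ hF, countFresh_lift_bind σ _ (ρ.vars_subset.trans hF)]
  gcongr with x
  exact hR ρ hρ x

theorem countFresh_lt_of_rewrite_diamondTRS {s t : Term (S.adjoin 1) V}
    (h : (diamondTRS (V := V)).Rewrite s t) : t.countFresh < s.countFresh := by
  have closed : ContextClosed fun s t : Term (S.adjoin 1) V => t.countFresh < s.countFresh := by
    intro f ts i s t h
    obtain ⟨c, hc⟩ := exists_countFresh_app_update f ts i
    simpa only [hc, add_lt_add_iff_left] using h
  refine closed.contextClosure_le ?_ _ _ h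
  rintro _ _ ⟨_, ⟨x, rfl⟩, σ, rfl, rfl⟩
  calc (σ x).countFresh
      < 1 + ∑ _i : Fin 1, (σ x).countFresh := by simp

theorem boundedDuplicating_of_nonDuplicating (hR : NonDuplicating R) : BoundedDuplicating R := by
  have countFresh_le {s t : Term (S.adjoin 1) V} (h : ReflTransGen (R.lift 1).Step s t) :
      t.countFresh ≤ s.countFresh := by
    rw [step_eq_rewrite] at h
    induction h with
    | refl => exact le_rfl
    | tail _ h ih => exact (countFresh_le_of_rewrite_lift hR h).trans ih
  have countFresh_lt {s t : Term (S.adjoin 1) V} (h : RelStep diamondTRS (R.lift 1) s t) :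
      t.countFresh < s.countFresh := by
    obtain ⟨s', hs, t', h, ht⟩ := h
    rw [step_eq_rewrite] at h
    calc t.countFresh
        ≤ t'.countFresh := countFresh_le ht
      _ < s'.countFresh := countFresh_lt_of_rewrite_diamondTRS h
      _ ≤ s.countFresh := countFresh_le hs
  refine Subrelation.wf (fun {t s} h => ?_) (measure Term.countFresh).wf
  change t.countFresh < s.countFresh
  induction h with
  | single h => exact countFresh_lt h
  | tail _ h ih => exact (countFresh_lt h).trans ih

end NonDuplicating

end LayerTRS

theorem mainTheorem3 {S : LayerTRS.Signature.{u}} {V : Type v} [Infinite V]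
    (R : LayerTRS.TRS S V) (𝕃 : Set (LayerTRS.Ctx S V))
    (h𝕃 : LayerTRS.IsLayerSystem 𝕃)
    (hW : LayerTRS.WeaklyLayered R 𝕃)
    (hconf : LayerTRS.ConfluentOn R.Step {t | LayerTRS.rank 𝕃 t = 1}) :
    (LayerTRS.BoundedDuplicating R → LayerTRS.Confluent R.Step) ∧
      (LayerTRS.NonDuplicating R →
        LayerTRS.BoundedDuplicating R ∧ LayerTRS.Confluent R.Step) := by
  have confluent (hB : LayerTRS.BoundedDuplicating R) : LayerTRS.Confluent R.Step :=
    LayerTRS.confluent_of_boundedDuplicating h𝕃 hW hconf hB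
  refine ⟨confluent, fun hR => ?_⟩
  have hB := LayerTRS.boundedDuplicating_of_nonDuplicating hR
  exact ⟨hB, confluent hB⟩
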